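/- Let $(\Omega,\mathcal F,P)$ be a probability space with a filtration $(\mathcal F_s)$, let $w=(w^{(1)},\dots,w^{(d)})$ be a standard $d$-dimensional $(\mathcal F_s)$-Wiener process on $[0,\hat T]$ with independent components, let $0\le t<T\le\hat T$ and let $i_1\ne i_2$ be in $\{1,\dots,d\}$. Let $\{\phi_j\}_{j\ge0}$ be any complete orthonormal system in $L_2([t,T])$. Put $\zeta_j^{(i_1)}=\int_t^T\phi_j(\tau)\,dw_\tau^{(i_1)}$ and, for $m\ge 0$ and $s\in[t,T]$, let $$\bigl(w_s^{(i_1)}-w_t^{(i_1)}\bigr)^m=\sum_{j=0}^m\int_t^s\phi_j(\tau)\,d\tau\;\zeta_j^{(i_1)} .$$ Then the Itô integrals below exist (the one of $(w_s^{(i_1)}-w_t^{(i_1)})^m$ is taken with respect to the filtration obtained from $(\mathcal F_s)$ by adjoining the $\sigma$-algebra generated by $\{w^{(i_1)}_u : u\in[0,\hat T]\}$ at every time); almost surely, for every $m$, $$\int_t^T\bigl(w_s^{(i_1)}-w_t^{(i_1)}\bigr)^m dw_s^{(i_2)}=\sum_{j=0}^m\zeta_j^{(i_1)}\int_t^T\Bigl(\int_t^s\phi_j(\tau)\,d\tau\Bigr)dw_s^{(i_2)};$$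 and these approximations converge in mean square to the double Itô integral: $$\lim_{m\to\infty}E\left[\left(\int_t^T\int_t^s dw_\tau^{(i_1)}\,dw_s^{(i_2)}-\int_t^T\bigl(w_s^{(i_1)}-w_t^{(i_1)}\bigr)^m dw_s^{(i_2)}\right)^2\right]=0 .$$ -/

import Mathlib

open MeasureTheory ProbabilityTheory Filter Topology Set

/-- `w = (w 0, …, w (d-1))` is a standard `d`-dimensional Wiener process on the time interval
`[0, R]` with respect to the filtration `𝓕`, with independent components.  Only times in `[0, R]`
matter. -/
structure IsWienerProcess {Ω : Type*} {mΩ : MeasurableSpace Ω} (P : Measure Ω)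
    (𝓕 : Filtration ℝ mΩ) (R : ℝ) {d : ℕ} (w : Fin d → ℝ → Ω → ℝ) : Prop where
  /-- the process starts at zero -/
  zero : ∀ i, ∀ᵐ ω ∂P, w i 0 ω = 0
  /-- the process is adapted -/
  adapted : ∀ i, ∀ s ∈ Icc 0 R, Measurable[𝓕 s] (w i s)
  /-- the increment over `[s, u]` is Gaussian with mean zero and variance `u - s` -/
  gaussian : ∀ i, ∀ s u, 0 ≤ s → s ≤ u → u ≤ R →
    HasLaw (fun ω => w i u ω - w i s ω) (gaussianReal 0 (u - s).toNNReal) P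
  /-- the (vector) increment over `[s, u]` is independent of the past `𝓕 s` -/
  indep_past : ∀ s u, 0 ≤ s → s ≤ u → u ≤ R →
    Indep (MeasurableSpace.comap (fun ω => fun i => w i u ω - w i s ω) inferInstance) (𝓕 s) P
  /-- the components are independent processes -/
  indep_components : iIndepFun (fun i => fun ω => fun s : Icc (0 : ℝ) R => w i s ω) P
  /-- almost all paths are continuous -/
  continuous : ∀ i, ∀ᵐ ω ∂P, ContinuousOn (fun s => w i s ω) (Icc 0 R)

/-- The filtration `s ↦ 𝓕 s ∨ σ(w i u : u ∈ [0, R])`, obtained from `𝓕` by adjoining the whole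
path of the `i`-th component of a Wiener process at every time. -/
def IsWienerProcess.enlarge {Ω : Type*} {mΩ : MeasurableSpace Ω} {P : Measure Ω}
    {𝓕 : Filtration ℝ mΩ} {R : ℝ} {d : ℕ} {w : Fin d → ℝ → Ω → ℝ}
    (hw : IsWienerProcess P 𝓕 R w) (i : Fin d) : Filtration ℝ mΩ where
  seq s := 𝓕 s ⊔ ⨆ u ∈ Icc 0 R, MeasurableSpace.comap (w i u) inferInstance
  mono' _ _ h := sup_le_sup_right (𝓕.mono h) _
  le' s := sup_le (𝓕.le s) (iSup₂_le fun u hu =>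
    ((hw.adapted i u hu).mono (𝓕.le u) le_rfl).comap_le)

/-- A simple adapted process on `[a, b]`: the step process
`∑ k < n, coef k · 1_{(time k, time (k+1)]}` with square integrable coefficients `coef k` that are
measurable with respect to `𝓕 (time k)`. -/
structure SimpleAdapted {Ω : Type*} {mΩ : MeasurableSpace Ω} (P : Measure Ω)
    (𝓕 : Filtration ℝ mΩ) (a b : ℝ) where
  /-- number of steps -/
  n : ℕ
  /-- the partition points -/
  time : ℕ → ℝ
  /-- the coefficients -/
  coef : ℕ → Ω → ℝ
  mono : Monotone time
  mem : ∀ k, time k ∈ Icc a b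
  meas : ∀ k, Measurable[𝓕 (time k)] (coef k)
  memLp : ∀ k, MemLp (coef k) 2 P

namespace SimpleAdapted

variable {Ω : Type*} {mΩ : MeasurableSpace Ω} {P : Measure Ω} {𝓕 : Filtration ℝ mΩ} {a b : ℝ}

/-- The simple process as a function of time and `ω`. -/
noncomputable def val (H : SimpleAdapted P 𝓕 a b) (s : ℝ) (ω : Ω) : ℝ :=
  ∑ k ∈ Finset.range H.n, (Ioc (H.time k) (H.time (k + 1))).indicator (fun _ => H.coef k ω) s

/-- The Itô integral of a simple process:
`∑ k < n, coef k · (W (time (k+1)) - W (time k))`. -/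
noncomputable def integral (H : SimpleAdapted P 𝓕 a b) (W : ℝ → Ω → ℝ) (ω : Ω) : ℝ :=
  ∑ k ∈ Finset.range H.n, H.coef k ω * (W (H.time (k + 1)) ω - W (H.time k) ω)

end SimpleAdapted

/-- `HasItoIntegral P 𝓕 W a b f I`: the process `f` is Itô integrable over `[a, b]` with respect
to `W` and the filtration `𝓕`, and `I` is (a version of) the Itô integral `∫_a^b f_s dW_s`.
That is, `f ∈ L²([a, b] × Ω)` is a limit in `L²([a, b] × Ω)` of simple adapted processes whose
elementary stochastic integrals converge to `I` in mean square. -/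
def HasItoIntegral {Ω : Type*} {mΩ : MeasurableSpace Ω} (P : Measure Ω) (𝓕 : Filtration ℝ mΩ)
    (W : ℝ → Ω → ℝ) (a b : ℝ) (f : ℝ → Ω → ℝ) (I : Ω → ℝ) : Prop :=
  MemLp (Function.uncurry f) 2 ((volume.restrict (Icc a b)).prod P) ∧ MemLp I 2 P ∧
  ∃ H : ℕ → SimpleAdapted P 𝓕 a b,
    Tendsto (fun n => eLpNorm (fun p : ℝ × Ω => f p.1 p.2 - (H n).val p.1 p.2) 2
      ((volume.restrict (Icc a b)).prod P)) atTop (𝓝 0) ∧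
    Tendsto (fun n => eLpNorm (fun ω => I ω - (H n).integral W ω) 2 P) atTop (𝓝 0)

/-- `J` is (a version of) the iterated Itô integral `∫_t^T ∫_t^s dV_τ dW_s`: the inner integrals
`∫_t^s dV_τ`, `s ∈ [t, T]`, have versions `Y s` for which `J = ∫_t^T Y_s dW_s`. -/
def HasDoubleItoIntegral {Ω : Type*} {mΩ : MeasurableSpace Ω} (P : Measure Ω)
    (𝓕 : Filtration ℝ mΩ) (V W : ℝ → Ω → ℝ) (t T : ℝ) (J : Ω → ℝ) : Prop :=
  ∃ Y : ℝ → Ω → ℝ, (∀ s ∈ Icc t T, HasItoIntegral P 𝓕 V t s (fun _ _ => 1) (Y s)) ∧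
    HasItoIntegral P 𝓕 W t T Y J

/-- `φ 0, φ 1, …` is a complete orthonormal system in `L²([t, T])`. -/
def IsCompleteOrthonormalSystem (t T : ℝ) (φ : ℕ → ℝ → ℝ) : Prop :=
  ∃ h : ∀ j, MemLp (φ j) 2 (volume.restrict (Icc t T)),
    Orthonormal ℝ (fun j => (h j).toLp (φ j)) ∧
    (Submodule.span ℝ (range fun j => (h j).toLp (φ j))).topologicalClosure = ⊤

/-- The truncated expansion `∑ j ≤ m, (∫_t^s φ_j(τ) dτ) ζ_j` of the increment over `[t, s]` of a
Wiener process `W`, where `ζ_j` stands for `∫_t^T φ_j dW`. -/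
noncomputable def truncatedIncrement {Ω : Type*} (φ : ℕ → ℝ → ℝ) (ζ : ℕ → Ω → ℝ) (t : ℝ) (m : ℕ)
    (s : ℝ) (ω : Ω) : ℝ :=
  ∑ j ∈ Finset.range (m + 1), (∫ τ in t..s, φ j τ) * ζ j ω

/-!
The Itô integral of this file is an isometry: for simple processes `H`, `K`, on possibly different
partitions, `E[∫ H dW ∫ K dW] = E ∫ H K ds` (`SimpleAdapted.integral_integral_mul`), and this passes
to linear combinations of integrals (`HasItoIntegral.eLpNorm_sub_sum`). It only uses adaptedness,
Gaussian increments and independence of increments from the past, collected in `IsBrownianRelTo`.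
Uniqueness of integrals, existence for mean-square continuous integrands and for deterministic
square integrable ones, and the identification of sums of integrals all follow from it.

Let `𝓖` be the filtration enlarged by the path of `w i₁`. The vector increments after `s` are
independent of `𝓕 s`, and the two components are independent, so the increments of `w i₂` after `s`
are independent of `𝓖 s` (`IsWienerProcess.isBrownianRelTo_enlarge`): the isometry is available for
`w i₂` and `𝓖`. A Wiener integral `ζ j` of `φ j` has a version determined by the path of `w i₁`
(`IsWienerProcess.exists_measurable_path_ae_eq`), hence known at time `t` in `𝓖`, and may be pulled
out of the integral with respect to `w i₂` (`HasItoIntegral.mul_const`). This yields the formula for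
the approximations.

By the isometry for `w i₂` and `𝓖`, the mean square error is the norm in `L²([t, T] × Ω)` of the
difference between the increment of `w i₁` and its truncated expansion. By the isometry for `w i₁`,
its slice at time `s` is the remainder of the expansion of the indicator of `(t, s]` in the system
`φ`. These remainders tend to zero by completeness and are bounded by the norm of the constant `1`,
so dominated convergence in `s` finishes the proof (`tendsto_eLpNorm_sub_truncatedIncrement`).
-/

/-! ### Independence and enlargement of the filtration -/

/-- If `m₁, m₂` are independent and `m₁ ⊔ m₂` is independent of `m₃`, then `m₂` is independent of
`m₁ ⊔ m₃`. -/
theorem ProbabilityTheory.Indep.sup_right_of_sup_left {Ω : Type*} {m₁ m₂ m₃ mΩ : MeasurableSpace Ω}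
    {P : Measure Ω} [IsProbabilityMeasure P] (h₁ : m₁ ≤ mΩ) (h₂ : m₂ ≤ mΩ) (h₃ : m₃ ≤ mΩ)
    (h : Indep m₁ m₂ P) (h' : Indep (m₁ ⊔ m₂) m₃ P) : Indep m₂ (m₁ ⊔ m₃) P := by
  have hgen : m₁ ⊔ m₃ = MeasurableSpace.generateFrom
      (image2 (· ∩ ·) {s | MeasurableSet[m₁] s} {s | MeasurableSet[m₃] s}) := by
    refine le_antisymm (sup_le (fun a ha => ?_) (fun a ha => ?_))
      (MeasurableSpace.generateFrom_le ?_)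
    · exact MeasurableSpace.measurableSet_generateFrom
        ⟨a, ha, univ, MeasurableSet.univ, inter_univ a⟩
    · exact MeasurableSpace.measurableSet_generateFrom
        ⟨univ, MeasurableSet.univ, a, ha, univ_inter a⟩
    · rintro _ ⟨a, ha, b, hb, rfl⟩
      exact ((le_sup_left : m₁ ≤ m₁ ⊔ m₃) a ha).inter ((le_sup_right : m₃ ≤ m₁ ⊔ m₃) b hb)
  refine IndepSets.indep h₂ (sup_le h₁ h₃) (@MeasurableSpace.isPiSystem_measurableSet Ω m₂) ?_
    (@MeasurableSpace.generateFrom_measurableSet Ω m₂).symm hgen ?_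
  · rintro _ ⟨a, ha, b, hb, rfl⟩ _ ⟨a', ha', b', hb', rfl⟩ -
    refine ⟨a ∩ a', MeasurableSet.inter ha ha', b ∩ b', MeasurableSet.inter hb hb', ?_⟩
    exact inter_inter_inter_comm a a' b b'
  · rw [IndepSets_iff]
    rintro c _ hc ⟨a, ha, b, hb, rfl⟩
    have e₁ : P (c ∩ (a ∩ b)) = P (a ∩ c) * P b := by
      rw [← inter_assoc, inter_comm c a]
      exact (Indep_iff _ _ _).1 h' _ _ (((le_sup_left : m₁ ≤ m₁ ⊔ m₂) a ha).inter
        ((le_sup_right : m₂ ≤ m₁ ⊔ m₂) c hc)) hb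
    have e₂ : P (a ∩ c) = P a * P c := (Indep_iff _ _ _).1 h _ _ ha hc
    have e₃ : P (a ∩ b) = P a * P b := (Indep_iff _ _ _).1 h' _ _
      ((le_sup_left : m₁ ≤ m₁ ⊔ m₂) a ha) hb
    simp only [e₁, e₂, e₃]
    ring

section Wiener

variable {Ω : Type*} {mΩ : MeasurableSpace Ω} {P : Measure Ω}

/-- The distributional properties of a real Wiener process on `[0, R]` relative to a filtration that
make its Itô integral an isometry: adaptedness, Gaussian increments, and independence of each
increment from the past.  Path continuity is not part of it. -/
structure IsBrownianRelTo (P : Measure Ω) (𝓖 : Filtration ℝ mΩ) (R : ℝ) (W : ℝ → Ω → ℝ) :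
    Prop where
  adapted : ∀ s ∈ Icc 0 R, Measurable[𝓖 s] (W s)
  gaussian : ∀ s u, 0 ≤ s → s ≤ u → u ≤ R →
    HasLaw (fun ω => W u ω - W s ω) (gaussianReal 0 (u - s).toNNReal) P
  indep : ∀ s u, 0 ≤ s → s ≤ u → u ≤ R →
    Indep (MeasurableSpace.comap (fun ω => W u ω - W s ω) inferInstance) (𝓖 s) P

theorem IsBrownianRelTo.of_le {𝓖 𝓗 : Filtration ℝ mΩ} {R : ℝ} {W : ℝ → Ω → ℝ}
    (hW : IsBrownianRelTo P 𝓖 R W) (hle : ∀ s, 𝓗 s ≤ 𝓖 s)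
    (hadp : ∀ s ∈ Icc 0 R, Measurable[𝓗 s] (W s)) : IsBrownianRelTo P 𝓗 R W where
  adapted := hadp
  gaussian := hW.gaussian
  indep s u hs hsu hu := indep_of_indep_of_le_right (hW.indep s u hs hsu hu) (hle s)

variable {𝓕 : Filtration ℝ mΩ} {R : ℝ} {d : ℕ} {w : Fin d → ℝ → Ω → ℝ}

namespace IsWienerProcess

theorem measurable (hw : IsWienerProcess P 𝓕 R w) (i : Fin d) {s : ℝ} (hs : s ∈ Icc 0 R) :
    Measurable (w i s) :=
  (hw.adapted i s hs).mono (𝓕.le s) le_rfl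

theorem isBrownianRelTo (hw : IsWienerProcess P 𝓕 R w) (i : Fin d) :
    IsBrownianRelTo P 𝓕 R (w i) where
  adapted := hw.adapted i
  gaussian := hw.gaussian i
  indep s u hs hsu hu := by
    refine indep_of_indep_of_le_left (hw.indep_past s u hs hsu hu) ?_
    refine Measurable.comap_le (m₁ := MeasurableSpace.comap _ _) ?_
    exact (measurable_pi_apply i).comp (comap_measurable (fun ω => fun i => w i u ω - w i s ω))

/-- The vector increment of `w` over `[s, v]`. -/
def increment (w : Fin d → ℝ → Ω → ℝ) (s v : ℝ) (ω : Ω) : Fin d → ℝ := fun i => w i v ω - w i s ω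

theorem measurable_increment (hw : IsWienerProcess P 𝓕 R w) {s v u : ℝ} (hs : s ∈ Icc 0 R)
    (hv : v ∈ Icc 0 R) (hsu : s ≤ u) (hvu : v ≤ u) : Measurable[𝓕 u] (increment w s v) :=
  @measurable_pi_lambda _ _ _ (𝓕 u) _ _ fun i =>
    ((hw.adapted i v hv).mono (𝓕.mono hvu) le_rfl).sub
      ((hw.adapted i s hs).mono (𝓕.mono hsu) le_rfl)

/-- The past at time `s` is independent of finitely many later increments: the latest increment is
split off and the independence of the others is known by induction. -/
theorem indep_past_finset [IsProbabilityMeasure P]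
    (hw : IsWienerProcess P 𝓕 R w) {s : ℝ} (hs : s ∈ Icc 0 R)
    (S : Finset ℝ) (hS : ∀ v ∈ S, v ∈ Icc s R) :
    Indep (𝓕 s) (⨆ v ∈ S, MeasurableSpace.comap (increment w s v) inferInstance) P := by
  induction S using Finset.induction_on_max with
  | empty => simpa using indep_bot_right (𝓕 s)
  | insert v S hlt ih =>
    have ih' := ih fun x hx => hS x (Finset.mem_insert_of_mem hx)
    have hv := hS v (Finset.mem_insert_self v S)
    -- the time preceding `v` in `S ∪ {s}`
    obtain ⟨r, hr, hrv, hrS, hrr⟩ : ∃ r ∈ Icc s R, r ≤ v ∧ (∀ x ∈ S, x ≤ r) ∧ (r = s ∨ r ∈ S) := by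
      rcases S.eq_empty_or_nonempty with rfl | hne
      · exact ⟨s, ⟨le_rfl, hs.2⟩, hv.1, by simp, Or.inl rfl⟩
      · exact ⟨S.max' hne, hS _ (Finset.mem_insert_of_mem (S.max'_mem hne)),
          (hlt _ (S.max'_mem hne)).le, fun x hx => S.le_max' x hx, Or.inr (S.max'_mem hne)⟩
    have hr0 : r ∈ Icc 0 R := ⟨hs.1.trans hr.1, hr.2⟩
    have hB : (⨆ x ∈ S, MeasurableSpace.comap (increment w s x) inferInstance) ≤ 𝓕 r :=
      iSup₂_le fun x hx => (hw.measurable_increment hs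
        ⟨hs.1.trans (hS x (Finset.mem_insert_of_mem hx)).1,
          (hS x (Finset.mem_insert_of_mem hx)).2⟩ hr.1 (hrS x hx)).comap_le
    have hC : MeasurableSpace.comap (increment w r v) inferInstance ≤ mΩ :=
      (hw.measurable_increment hr0 ⟨hs.1.trans hv.1, hv.2⟩ hrv le_rfl).comap_le.trans (𝓕.le v)
    have hind := hw.indep_past r v hr0.1 hrv hv.2
    have key : Indep (𝓕 s) ((⨆ x ∈ S, MeasurableSpace.comap (increment w s x) inferInstance) ⊔
        MeasurableSpace.comap (increment w r v) inferInstance) P := by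
      refine Indep.sup_right_of_sup_left (hB.trans (𝓕.le r)) (𝓕.le s) hC ih'.symm ?_
      exact indep_of_indep_of_le_left hind.symm (sup_le hB (𝓕.mono hr.1))
    refine indep_of_indep_of_le_right key ?_
    rw [Finset.iSup_insert]
    refine sup_le ?_ le_sup_left
    set m := (⨆ x ∈ S, MeasurableSpace.comap (increment w s x) inferInstance) ⊔
        MeasurableSpace.comap (increment w r v) inferInstance with hm
    refine Measurable.comap_le (m₁ := m) ?_
    have h1 : Measurable[m] (increment w r v) :=
      (comap_measurable (increment w r v)).mono le_sup_right le_rfl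
    have h2 : Measurable[m] (increment w s r) := by
      rcases hrr with rfl | hrS'
      · have : increment w r r = fun _ _ => 0 := by ext ω i; simp [increment]
        rw [this]; exact measurable_const
      · exact (comap_measurable (increment w s r)).mono ((le_iSup₂ (f := fun x (_ : x ∈ S) =>
          MeasurableSpace.comap (increment w s x) inferInstance) r hrS').trans le_sup_left) le_rfl
    have h3 : increment w s v = fun ω => increment w r v ω + increment w s r ω := by
      ext ω i; simp [increment]
    rw [h3]
    exact h1.add h2

/-- The past at time `s` is independent of all later increments. -/
theorem indep_past_future [IsProbabilityMeasure P]
    (hw : IsWienerProcess P 𝓕 R w) {s : ℝ} (hs : s ∈ Icc 0 R) :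
    Indep (𝓕 s) (⨆ v : Icc s R, MeasurableSpace.comap (increment w s v) inferInstance) P := by
  have hle : ∀ v ∈ Icc s R, MeasurableSpace.comap (increment w s v) inferInstance ≤ mΩ :=
    fun v hv => (hw.measurable_increment hs ⟨hs.1.trans hv.1, hv.2⟩ hv.1 le_rfl).comap_le.trans
      (𝓕.le v)
  have h := indep_iSup_of_directed_le (μ := P) (m1 := 𝓕 s)
    (m := fun S : Finset (Icc s R) => ⨆ v ∈ S.map (Function.Embedding.subtype _),
      MeasurableSpace.comap (increment w s v) inferInstance)
    (fun S => (hw.indep_past_finset hs _ (by simp +contextual)).symm)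
    (fun S => iSup₂_le fun v hv => hle v (by
      obtain ⟨x, -, rfl⟩ := Finset.mem_map.1 hv; exact x.2)) (𝓕.le s) ?_
  · refine indep_of_indep_of_le_right h.symm (iSup_le fun v => ?_)
    refine le_trans ?_ (le_iSup _ {v})
    simp
  · refine Monotone.directed_le fun S S' hS => ?_
    exact biSup_mono fun v hv => Finset.map_subset_map.2 hS hv

theorem le_enlarge (hw : IsWienerProcess P 𝓕 R w) (i : Fin d) (s : ℝ) : 𝓕 s ≤ hw.enlarge i s :=
  le_sup_left

theorem path_le_enlarge (hw : IsWienerProcess P 𝓕 R w) (i : Fin d) (s : ℝ) :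
    (⨆ u ∈ Icc 0 R, MeasurableSpace.comap (w i u) inferInstance) ≤ hw.enlarge i s :=
  le_sup_right

/-- A component of the Wiener process remains a Wiener process after the whole path of another
component has been adjoined to the filtration. -/
theorem isBrownianRelTo_enlarge [IsProbabilityMeasure P]
    (hw : IsWienerProcess P 𝓕 R w) {i j : Fin d} (hij : i ≠ j) :
    IsBrownianRelTo P (hw.enlarge i) R (w j) where
  adapted s hs := (hw.adapted j s hs).mono (hw.le_enlarge i s) le_rfl
  gaussian := hw.gaussian j
  indep s u hs hsu hu := by
    have hs' : s ∈ Icc 0 R := ⟨hs, hsu.trans hu⟩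
    have hu' : u ∈ Icc 0 R := ⟨hs.trans hsu, hu⟩
    set C := MeasurableSpace.comap (fun ω => w j u ω - w j s ω) inferInstance with hC
    set B := ⨆ v ∈ Icc s R, MeasurableSpace.comap (fun ω => w i v ω - w i s ω) inferInstance
      with hB
    have hCle : C ≤ mΩ := ((hw.measurable j hu').sub (hw.measurable j hs')).comap_le
    have hBle : B ≤ mΩ := iSup₂_le fun v hv =>
      ((hw.measurable i ⟨hs.trans hv.1, hv.2⟩).sub (hw.measurable i hs')).comap_le
    have hpath : ∀ k : Fin d, ∀ v (hv : v ∈ Icc 0 R),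
        Measurable[MeasurableSpace.comap (fun ω => fun s : Icc (0 : ℝ) R => w k s ω) inferInstance]
          (w k v) := fun k v hv =>
      (measurable_pi_apply (⟨v, hv⟩ : Icc (0 : ℝ) R)).comp
        (comap_measurable (fun ω => fun s : Icc (0 : ℝ) R => w k s ω))
    -- the increments of distinct components are independent
    have hBC : Indep B C P := by
      have h := (hw.indep_components.indepFun hij)
      rw [IndepFun_iff_Indep] at h
      refine indep_of_indep_of_le h (iSup₂_le fun v hv => ?_) ?_
      · exact Measurable.comap_le (m₁ := MeasurableSpace.comap _ _)
          ((hpath i v ⟨hs.trans hv.1, hv.2⟩).sub (hpath i s hs'))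
      · exact Measurable.comap_le (m₁ := MeasurableSpace.comap _ _)
          ((hpath j u hu').sub (hpath j s hs'))
    have hBCF : Indep (B ⊔ C) (𝓕 s) P := by
      refine indep_of_indep_of_le_left (hw.indep_past_future hs').symm ?_
      have hk : ∀ k : Fin d, ∀ v ∈ Icc s R,
          MeasurableSpace.comap (fun ω => w k v ω - w k s ω) inferInstance ≤
          ⨆ v : Icc s R, MeasurableSpace.comap (increment w s v) inferInstance := by
        intro k v hv
        refine le_trans ?_ (le_iSup _ (⟨v, hv⟩ : Icc s R))
        exact Measurable.comap_le (m₁ := MeasurableSpace.comap _ _)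
          ((measurable_pi_apply k).comp (comap_measurable (increment w s v)))
      exact sup_le (iSup₂_le fun v hv => hk i v hv) (hk j u ⟨hsu, hu⟩)
    refine indep_of_indep_of_le_right
      (Indep.sup_right_of_sup_left hBle hCle (𝓕.le s) hBC hBCF) ?_
    refine sup_le le_sup_right (iSup₂_le fun v hv => ?_)
    have hsm : Measurable[B ⊔ 𝓕 s] (w i s) := (hw.adapted i s hs').mono le_sup_right le_rfl
    refine Measurable.comap_le (m₁ := B ⊔ 𝓕 s) ?_
    rcases le_total v s with hvs | hsv
    · exact (hw.adapted i v hv).mono ((𝓕.mono hvs).trans le_sup_right) le_rfl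
    · have h1 : Measurable[B ⊔ 𝓕 s] (fun ω => w i v ω - w i s ω) :=
        (comap_measurable (fun ω => w i v ω - w i s ω)).mono
          ((le_iSup₂ (f := fun v (_ : v ∈ Icc s R) => MeasurableSpace.comap
            (fun ω => w i v ω - w i s ω) inferInstance) v ⟨hsv, hv.2⟩).trans le_sup_left) le_rfl
      have h2 : w i v = fun ω => (w i v ω - w i s ω) + w i s ω := by ext ω; ring
      rw [h2]
      exact h1.add hsm

end IsWienerProcess

end Wiener

/-! ### The Itô isometry for simple processes -/

section SimpleIsometry

theorem MeasureTheory.MemLp.integrable_fun_mul {α : Type*} {m : MeasurableSpace α} {μ : Measure α}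
    {f g : α → ℝ} (hf : MemLp f 2 μ) (hg : MemLp g 2 μ) : Integrable (fun x => f x * g x) μ :=
  hf.integrable_mul hg

variable {Ω : Type*} {mΩ : MeasurableSpace Ω} {P : Measure Ω}
  {𝓖 : Filtration ℝ mΩ} {R : ℝ} {W : ℝ → Ω → ℝ}

namespace IsBrownianRelTo

theorem memLp_increment (hW : IsBrownianRelTo P 𝓖 R W) {s u : ℝ} (hs : 0 ≤ s) (hsu : s ≤ u)
    (hu : u ≤ R) : MemLp (fun ω => W u ω - W s ω) 2 P := by
  have h := hW.gaussian s u hs hsu hu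
  have h' : MemLp id 2 (P.map fun ω => W u ω - W s ω) := by
    rw [h.map_eq]
    exact memLp_id_gaussianReal' 2 (by simp)
  exact h'.comp_of_map h.aemeasurable

theorem integral_increment (hW : IsBrownianRelTo P 𝓖 R W) {s u : ℝ} (hs : 0 ≤ s) (hsu : s ≤ u)
    (hu : u ≤ R) : ∫ ω, W u ω - W s ω ∂P = 0 := by
  rw [(hW.gaussian s u hs hsu hu).integral_eq, integral_id_gaussianReal]

theorem integral_increment_sq (hW : IsBrownianRelTo P 𝓖 R W) {s u : ℝ} (hs : 0 ≤ s)
    (hsu : s ≤ u) (hu : u ≤ R) : ∫ ω, (W u ω - W s ω) ^ 2 ∂P = u - s := by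
  have h := (hW.gaussian s u hs hsu hu).variance_eq
  rw [variance_id_gaussianReal, variance_of_integral_eq_zero
    (hW.gaussian s u hs hsu hu).aemeasurable (hW.integral_increment hs hsu hu)] at h
  rw [h, Real.coe_toNNReal _ (sub_nonneg.2 hsu)]

theorem indepFun_increment (hW : IsBrownianRelTo P 𝓖 R W) {s u : ℝ} (hs : 0 ≤ s)
    (hsu : s ≤ u) (hu : u ≤ R) {X : Ω → ℝ} (hX : Measurable[𝓖 s] X) :
    IndepFun X (fun ω => W u ω - W s ω) P := by
  rw [IndepFun_iff_Indep]
  exact indep_of_indep_of_le_left (hW.indep s u hs hsu hu).symm hX.comap_le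

theorem integral_mul_increment [IsProbabilityMeasure P]
    (hW : IsBrownianRelTo P 𝓖 R W) {s u : ℝ} (hs : 0 ≤ s)
    (hsu : s ≤ u) (hu : u ≤ R) {X : Ω → ℝ} (hX : Measurable[𝓖 s] X) :
    ∫ ω, X ω * (W u ω - W s ω) ∂P = 0 := by
  rw [(hW.indepFun_increment hs hsu hu hX).integral_fun_mul_eq_mul_integral
    (hX.mono (𝓖.le s) le_rfl).aestronglyMeasurable
    (hW.memLp_increment hs hsu hu).aestronglyMeasurable, hW.integral_increment hs hsu hu, mul_zero]

theorem integral_mul_increment_sq [IsProbabilityMeasure P]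
    (hW : IsBrownianRelTo P 𝓖 R W) {s u : ℝ} (hs : 0 ≤ s)
    (hsu : s ≤ u) (hu : u ≤ R) {X : Ω → ℝ} (hX : Measurable[𝓖 s] X) :
    ∫ ω, X ω * (W u ω - W s ω) ^ 2 ∂P = (∫ ω, X ω ∂P) * (u - s) := by
  have hind : IndepFun X (fun ω => (W u ω - W s ω) ^ 2) P :=
    (hW.indepFun_increment hs hsu hu hX).comp (φ := id) (ψ := fun x => x ^ 2) measurable_id
      (measurable_id.pow_const 2)
  rw [hind.integral_fun_mul_eq_mul_integral
    (hX.mono (𝓖.le s) le_rfl).aestronglyMeasurable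
    ((hW.memLp_increment hs hsu hu).aestronglyMeasurable.pow 2),
    hW.integral_increment_sq hs hsu hu]

theorem memLp_mul_increment [IsProbabilityMeasure P]
    (hW : IsBrownianRelTo P 𝓖 R W) {s u : ℝ} (hs : 0 ≤ s)
    (hsu : s ≤ u) (hu : u ≤ R) {X : Ω → ℝ} (hX : Measurable[𝓖 s] X) (hX2 : MemLp X 2 P) :
    MemLp (fun ω => X ω * (W u ω - W s ω)) 2 P := by
  have hD := hW.memLp_increment hs hsu hu
  refine (memLp_two_iff_integrable_sq (hX2.aestronglyMeasurable.mul hD.aestronglyMeasurable)).2 ?_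
  have hind := (hW.indepFun_increment hs hsu hu hX).comp (φ := fun x => x ^ 2)
    (ψ := fun x => x ^ 2) (measurable_id.pow_const 2) (measurable_id.pow_const 2)
  refine (hind.integrable_mul hX2.integrable_sq hD.integrable_sq).congr (ae_of_all _ fun ω => ?_)
  simp [mul_pow]

/-- Covariance of `c (W u - W s)` and `e (W v - W s)`, two increments from the same time `s`. -/
theorem integral_mul_increment_mul_mul_increment_of_eq [IsProbabilityMeasure P]
    (hW : IsBrownianRelTo P 𝓖 R W)
    {s u v : ℝ} (hs : 0 ≤ s) (hsu : s ≤ u) (huv : u ≤ v) (hv : v ≤ R) {c e : Ω → ℝ}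
    (hc : Measurable[𝓖 s] c) (he : Measurable[𝓖 s] e) (hc2 : MemLp c 2 P) (he2 : MemLp e 2 P) :
    ∫ ω, (c ω * (W u ω - W s ω)) * (e ω * (W v ω - W s ω)) ∂P =
      (∫ ω, c ω * e ω ∂P) * (u - s) := by
  have hu : u ≤ R := huv.trans hv
  have hu0 : 0 ≤ u := hs.trans hsu
  have hcu := hW.memLp_mul_increment hs hsu hu hc hc2
  have heu := hW.memLp_mul_increment hs hsu hu he he2
  have heu' : Measurable[𝓖 u] e := he.mono (𝓖.mono hsu) le_rfl
  have hev := hW.memLp_mul_increment hu0 huv hv heu' he2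
  have hsplit : ∀ ω, (c ω * (W u ω - W s ω)) * (e ω * (W v ω - W s ω)) =
      (c ω * (W u ω - W s ω)) * (e ω * (W u ω - W s ω)) +
      (c ω * (W u ω - W s ω)) * (e ω * (W v ω - W u ω)) := fun ω => by ring
  simp_rw [hsplit]
  have hzero : ∫ ω, (c ω * (W u ω - W s ω)) * (e ω * (W v ω - W u ω)) ∂P = 0 := by
    have hX : Measurable[𝓖 u] fun ω => (c ω * (W u ω - W s ω)) * e ω :=
      ((hc.mono (𝓖.mono hsu) le_rfl).mul ((hW.adapted u ⟨hu0, hu⟩).sub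
        ((hW.adapted s ⟨hs, hsu.trans hu⟩).mono (𝓖.mono hsu) le_rfl))).mul heu'
    rw [← hW.integral_mul_increment hu0 huv hv hX]
    simp_rw [mul_assoc]
  rw [integral_add (hcu.integrable_fun_mul heu) (hcu.integrable_fun_mul hev), hzero, add_zero,
    ← hW.integral_mul_increment_sq hs hsu hu (X := fun ω => c ω * e ω) (hc.mul he)]
  refine integral_congr_ae (ae_of_all _ fun ω => ?_)
  ring

theorem integral_mul_increment_mul_mul_increment_of_le [IsProbabilityMeasure P]
    (hW : IsBrownianRelTo P 𝓖 R W)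
    {s u s' u' : ℝ} (hs : 0 ≤ s) (hsu : s ≤ u) (hu : u ≤ R) (hsu' : s' ≤ u')
    (hu' : u' ≤ R) (hss' : s ≤ s') {c e : Ω → ℝ}
    (hc : Measurable[𝓖 s] c) (he : Measurable[𝓖 s'] e) (hc2 : MemLp c 2 P) (he2 : MemLp e 2 P) :
    ∫ ω, (c ω * (W u ω - W s ω)) * (e ω * (W u' ω - W s' ω)) ∂P =
      (∫ ω, c ω * e ω ∂P) * max (min u u' - max s s') 0 := by
  have hs' : 0 ≤ s' := hs.trans hss'
  have hs'R : s' ≤ R := hsu'.trans hu'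
  -- disjoint intervals are uncorrelated
  have hdisj : ∀ r, s ≤ r → r ≤ s' →
      ∫ ω, (c ω * (W r ω - W s ω)) * (e ω * (W u' ω - W s' ω)) ∂P = 0 := by
    intro r hsr hrs'
    have hX : Measurable[𝓖 s'] fun ω => (c ω * (W r ω - W s ω)) * e ω :=
      ((hc.mono (𝓖.mono hss') le_rfl).mul
        (((hW.adapted r ⟨hs.trans hsr, hrs'.trans hs'R⟩).mono (𝓖.mono hrs') le_rfl).sub
        ((hW.adapted s ⟨hs, hss'.trans hs'R⟩).mono (𝓖.mono hss') le_rfl))).mul he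
    rw [← hW.integral_mul_increment hs' hsu' hu' hX]
    simp_rw [mul_assoc]
  rcases le_total u s' with h | h
  · rw [hdisj u hsu h, max_eq_right, mul_zero]
    rw [max_eq_right hss']
    linarith [min_le_left u u']
  · have hc' : Measurable[𝓖 s'] c := hc.mono (𝓖.mono hss') le_rfl
    have hsplit : ∀ ω, (c ω * (W u ω - W s ω)) * (e ω * (W u' ω - W s' ω)) =
        (c ω * (W s' ω - W s ω)) * (e ω * (W u' ω - W s' ω)) +
        (c ω * (W u ω - W s' ω)) * (e ω * (W u' ω - W s' ω)) := fun ω => by ring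
    have he' := hW.memLp_mul_increment hs' hsu' hu' he he2
    simp_rw [hsplit]
    rw [integral_add ((hW.memLp_mul_increment hs hss' hs'R hc hc2).integrable_fun_mul he')
      ((hW.memLp_mul_increment hs' h hu hc' hc2).integrable_fun_mul he'), hdisj s' hss' le_rfl,
      zero_add, max_eq_right hss', max_eq_left (sub_nonneg.2 (le_min h hsu'))]
    rcases le_total u u' with huu | huu
    · rw [hW.integral_mul_increment_mul_mul_increment_of_eq hs' h huu hu' hc' he hc2 he2,
        min_eq_left huu]
    · rw [min_eq_right huu]
      simp_rw [fun ω => mul_comm (c ω * (W u ω - W s' ω)) (e ω * (W u' ω - W s' ω)),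
        fun ω => mul_comm (c ω) (e ω)]
      exact hW.integral_mul_increment_mul_mul_increment_of_eq hs' hsu' huu hu he hc' he2 hc2

/-- Covariance of `c (W u - W s)` and `e (W u' - W s')`: the expectation of `c e` times the length
of the overlap of the two intervals. -/
theorem integral_mul_increment_mul_mul_increment [IsProbabilityMeasure P]
    (hW : IsBrownianRelTo P 𝓖 R W)
    {s u s' u' : ℝ} (hs : 0 ≤ s) (hsu : s ≤ u) (hu : u ≤ R) (hs' : 0 ≤ s') (hsu' : s' ≤ u')
    (hu' : u' ≤ R) {c e : Ω → ℝ}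
    (hc : Measurable[𝓖 s] c) (he : Measurable[𝓖 s'] e) (hc2 : MemLp c 2 P) (he2 : MemLp e 2 P) :
    ∫ ω, (c ω * (W u ω - W s ω)) * (e ω * (W u' ω - W s' ω)) ∂P =
      (∫ ω, c ω * e ω ∂P) * max (min u u' - max s s') 0 := by
  rcases le_total s s' with h | h
  · exact hW.integral_mul_increment_mul_mul_increment_of_le hs hsu hu hsu' hu' h hc he hc2 he2
  · rw [min_comm, max_comm s s']
    simp_rw [fun ω => mul_comm (c ω * (W u ω - W s ω)) (e ω * (W u' ω - W s' ω)),
        fun ω => mul_comm (c ω) (e ω)]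
    exact hW.integral_mul_increment_mul_mul_increment_of_le hs' hsu' hu' hsu hu h he hc he2 hc2

end IsBrownianRelTo

variable [IsProbabilityMeasure P]

/-- The elementary process `c · 1_{(s, u]}` is square integrable. -/
theorem memLp_indicator_Ioc {a b s u : ℝ} {c : Ω → ℝ} (hc : MemLp c 2 P) :
    MemLp (fun p : ℝ × Ω => (Ioc s u).indicator (fun _ => c p.2) p.1) 2
      ((volume.restrict (Icc a b)).prod P) := by
  have h : (fun p : ℝ × Ω => (Ioc s u).indicator (fun _ => c p.2) p.1) =
      (Ioc s u ×ˢ univ).indicator (fun p => c p.2) := by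
    ext p
    by_cases hp : p.1 ∈ Ioc s u <;> simp [indicator, hp]
  rw [h]
  exact (hc.comp_snd _).indicator (measurableSet_Ioc.prod MeasurableSet.univ)

theorem integral_indicator_Ioc_mul_indicator_Ioc {a b s u s' u' : ℝ} (hs : a ≤ s) (hu : u ≤ b)
    {c e : Ω → ℝ} :
    ∫ p : ℝ × Ω, (Ioc s u).indicator (fun _ => c p.2) p.1 *
      (Ioc s' u').indicator (fun _ => e p.2) p.1 ∂((volume.restrict (Icc a b)).prod P) =
      (∫ ω, c ω * e ω ∂P) * max (min u u' - max s s') 0 := by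
  have h : (fun p : ℝ × Ω => (Ioc s u).indicator (fun _ => c p.2) p.1 *
      (Ioc s' u').indicator (fun _ => e p.2) p.1) =
      fun p => (Ioc (max s s') (min u u')).indicator (fun _ => (1 : ℝ)) p.1 * (c p.2 * e p.2) := by
    ext p
    rw [← Ioc_inter_Ioc]
    by_cases h1 : p.1 ∈ Ioc s u <;> by_cases h2 : p.1 ∈ Ioc s' u' <;>
      simp only [indicator, mem_inter_iff, h1, h2] <;> simp
  have hsub : Ioc (max s s') (min u u') ⊆ Icc a b := fun x hx =>
    ⟨(hs.trans (le_max_left _ _)).trans hx.1.le, hx.2.trans ((min_le_left _ _).trans hu)⟩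
  rw [h, integral_prod_mul (fun x => (Ioc (max s s') (min u u')).indicator (fun _ => (1 : ℝ)) x)
    (fun ω => c ω * e ω), integral_indicator_const _ measurableSet_Ioc,
    measureReal_restrict_apply measurableSet_Ioc, inter_eq_self_of_subset_left hsub,
    Real.volume_real_Ioc, smul_eq_mul, mul_one, mul_comm]

namespace SimpleAdapted

variable {a b : ℝ}

theorem memLp_val (H : SimpleAdapted P 𝓖 a b) :
    MemLp (fun p : ℝ × Ω => H.val p.1 p.2) 2 ((volume.restrict (Icc a b)).prod P) :=
  memLp_finsetSum _ fun k _ => memLp_indicator_Ioc (H.memLp k)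

theorem memLp_integral (hW : IsBrownianRelTo P 𝓖 R W) (ha : 0 ≤ a) (hb : b ≤ R)
    (H : SimpleAdapted P 𝓖 a b) : MemLp (H.integral W) 2 P :=
  memLp_finsetSum _ fun k _ => hW.memLp_mul_increment (ha.trans (H.mem k).1)
    (H.mono k.le_succ) ((H.mem _).2.trans hb) (H.meas k) (H.memLp k)

/-- The Itô isometry for two simple processes, which may have different partitions. -/
theorem integral_integral_mul (hW : IsBrownianRelTo P 𝓖 R W) (ha : 0 ≤ a) (hb : b ≤ R)
    (H K : SimpleAdapted P 𝓖 a b) :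
    ∫ ω, H.integral W ω * K.integral W ω ∂P =
      ∫ p, H.val p.1 p.2 * K.val p.1 p.2 ∂((volume.restrict (Icc a b)).prod P) := by
  have hint : ∀ (H : SimpleAdapted P 𝓖 a b) k, MemLp (fun ω => H.coef k ω *
      (W (H.time (k + 1)) ω - W (H.time k) ω)) 2 P := fun H k =>
    hW.memLp_mul_increment (ha.trans (H.mem k).1)
      (H.mono k.le_succ) ((H.mem _).2.trans hb) (H.meas k) (H.memLp k)
  have hval : ∀ (H : SimpleAdapted P 𝓖 a b) k, MemLp (fun p : ℝ × Ω =>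
      (Ioc (H.time k) (H.time (k + 1))).indicator (fun _ => H.coef k p.2) p.1) 2
      ((volume.restrict (Icc a b)).prod P) := fun H k => memLp_indicator_Ioc (H.memLp k)
  simp only [integral, val, Finset.sum_mul_sum]
  rw [integral_finsetSum _ fun k _ => integrable_finsetSum _ fun l _ =>
      (hint H k).integrable_fun_mul (hint K l),
    integral_finsetSum _ fun k _ => integrable_finsetSum _ fun l _ =>
      (hval H k).integrable_fun_mul (hval K l)]
  refine Finset.sum_congr rfl fun k _ => ?_
  rw [integral_finsetSum _ fun l _ => (hint H k).integrable_fun_mul (hint K l),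
    integral_finsetSum _ fun l _ => (hval H k).integrable_fun_mul (hval K l)]
  refine Finset.sum_congr rfl fun l _ => ?_
  rw [hW.integral_mul_increment_mul_mul_increment (ha.trans (H.mem k).1) (H.mono k.le_succ)
    ((H.mem _).2.trans hb) (ha.trans (K.mem l).1) (K.mono l.le_succ) ((K.mem _).2.trans hb)
    (H.meas k) (K.meas l) (H.memLp k) (K.memLp l),
    integral_indicator_Ioc_mul_indicator_Ioc (H.mem k).1 (H.mem (k + 1)).2]

end SimpleAdapted

end SimpleIsometry

/-! ### The Itô isometry and existence of the integral -/

section L2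

variable {α : Type*} {m : MeasurableSpace α} {μ : Measure α}

theorem MeasureTheory.MemLp.inner_toLp_eq_integral {f g : α → ℝ} (hf : MemLp f 2 μ)
    (hg : MemLp g 2 μ) : inner ℝ (hf.toLp f) (hg.toLp g) = ∫ x, f x * g x ∂μ := by
  rw [L2.inner_def]
  refine integral_congr_ae ?_
  filter_upwards [hf.coeFn_toLp, hg.coeFn_toLp] with x h1 h2
  rw [h1, h2]
  simp [mul_comm]

theorem MeasureTheory.MemLp.eLpNorm_eq_sqrt_integral {f : α → ℝ} (hf : MemLp f 2 μ) :
    eLpNorm f 2 μ = ENNReal.ofReal √(∫ x, f x * f x ∂μ) := by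
  rw [← hf.inner_toLp_eq_integral hf, real_inner_self_eq_norm_sq, Real.sqrt_sq (norm_nonneg _),
    Lp.norm_toLp, ENNReal.ofReal_toReal hf.eLpNorm_ne_top]

theorem tendsto_toLp_of_eLpNorm {f : α → ℝ} {F : ℕ → α → ℝ} (hf : MemLp f 2 μ)
    (hF : ∀ n, MemLp (F n) 2 μ)
    (h : Tendsto (fun n => eLpNorm (fun x => f x - F n x) 2 μ) atTop (𝓝 0)) :
    Tendsto (fun n => (hF n).toLp (F n)) atTop (𝓝 (hf.toLp f)) := by
  rw [Lp.tendsto_Lp_iff_tendsto_eLpNorm'']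
  refine h.congr fun n => ?_
  rw [eLpNorm_sub_comm (F n) f]
  rfl

theorem tendsto_integral_mul_of_eLpNorm {f g : α → ℝ} {F G : ℕ → α → ℝ} (hf : MemLp f 2 μ)
    (hg : MemLp g 2 μ) (hF : ∀ n, MemLp (F n) 2 μ) (hG : ∀ n, MemLp (G n) 2 μ)
    (h : Tendsto (fun n => eLpNorm (fun x => f x - F n x) 2 μ) atTop (𝓝 0))
    (h' : Tendsto (fun n => eLpNorm (fun x => g x - G n x) 2 μ) atTop (𝓝 0)) :
    Tendsto (fun n => ∫ x, F n x * G n x ∂μ) atTop (𝓝 (∫ x, f x * g x ∂μ)) := by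
  rw [← hf.inner_toLp_eq_integral hg]
  simp_rw [fun n => ((hF n).inner_toLp_eq_integral (hG n)).symm]
  exact (tendsto_toLp_of_eLpNorm hf hF h).inner (tendsto_toLp_of_eLpNorm hg hG h')

theorem integral_mul_sub_sum {ι : Type*} {S : Finset ι} {a : ι → ℝ} {f g : α → ℝ} {F : ι → α → ℝ}
    (hf : MemLp f 2 μ) (hg : MemLp g 2 μ) (hF : ∀ j ∈ S, MemLp (F j) 2 μ) :
    ∫ x, g x * (f x - ∑ j ∈ S, a j * F j x) ∂μ =
      ∫ x, g x * f x ∂μ - ∑ j ∈ S, a j * ∫ x, g x * F j x ∂μ := by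
  have h : ∀ x, g x * (f x - ∑ j ∈ S, a j * F j x) =
      g x * f x - ∑ j ∈ S, a j * (g x * F j x) := fun x => by
    rw [mul_sub, Finset.mul_sum]
    congr 1
    exact Finset.sum_congr rfl fun j _ => by ring
  have hi : ∀ j ∈ S, Integrable (fun x => a j * (g x * F j x)) μ := fun j hj =>
    (hg.integrable_fun_mul (hF j hj)).const_mul (a j)
  simp_rw [h]
  rw [integral_sub (hg.integrable_fun_mul hf) (integrable_finsetSum _ hi), integral_finsetSum _ hi]
  simp_rw [integral_const_mul]

theorem memLp_sub_sum {ι : Type*} {S : Finset ι} {a : ι → ℝ} {f : α → ℝ} {F : ι → α → ℝ}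
    (hf : MemLp f 2 μ) (hF : ∀ j ∈ S, MemLp (F j) 2 μ) :
    MemLp (fun x => f x - ∑ j ∈ S, a j * F j x) 2 μ :=
  hf.sub (memLp_finsetSum S fun j hj => (hF j hj).const_mul (a j))

end L2

section ItoIntegral

variable {Ω : Type*} {mΩ : MeasurableSpace Ω} {P : Measure Ω}
  {𝓕 𝓖 : Filtration ℝ mΩ} {R : ℝ} {W : ℝ → Ω → ℝ} {a b : ℝ} {f g : ℝ → Ω → ℝ} {I J : Ω → ℝ}

/-- A simple process adapted to a filtration, seen as adapted to a larger one. -/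
def SimpleAdapted.ofLE (hle : ∀ s, 𝓕 s ≤ 𝓖 s) (H : SimpleAdapted P 𝓕 a b) :
    SimpleAdapted P 𝓖 a b where
  n := H.n
  time := H.time
  coef := H.coef
  mono := H.mono
  mem := H.mem
  meas k := (H.meas k).mono (hle _) le_rfl
  memLp := H.memLp

theorem HasItoIntegral.ofLE (hle : ∀ s, 𝓕 s ≤ 𝓖 s) (h : HasItoIntegral P 𝓕 W a b f I) :
    HasItoIntegral P 𝓖 W a b f I := by
  obtain ⟨hf, hI, H, h1, h2⟩ := h
  exact ⟨hf, hI, fun n => (H n).ofLE hle, h1, h2⟩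

theorem HasItoIntegral.congr (h : HasItoIntegral P 𝓕 W a b f I)
    (hfg : Function.uncurry f =ᵐ[(volume.restrict (Icc a b)).prod P] Function.uncurry g)
    (hIJ : I =ᵐ[P] J) : HasItoIntegral P 𝓕 W a b g J := by
  obtain ⟨hf, hI, H, h1, h2⟩ := h
  refine ⟨hf.ae_eq hfg, hI.ae_eq hIJ, H, h1.congr fun n => eLpNorm_congr_ae ?_,
    h2.congr fun n => eLpNorm_congr_ae ?_⟩
  · filter_upwards [hfg] with p hp
    have hp' : f p.1 p.2 = g p.1 p.2 := hp
    rw [hp']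
  · filter_upwards [hIJ] with ω hω
    rw [hω]

variable [IsProbabilityMeasure P]

theorem SimpleAdapted.hasItoIntegral (hW : IsBrownianRelTo P 𝓖 R W) (ha : 0 ≤ a) (hb : b ≤ R)
    (H : SimpleAdapted P 𝓖 a b) : HasItoIntegral P 𝓖 W a b H.val (H.integral W) :=
  ⟨H.memLp_val, H.memLp_integral hW ha hb, fun _ => H, by simp, by simp⟩

/-- The polarized Itô isometry. -/
theorem HasItoIntegral.integral_mul (hW : IsBrownianRelTo P 𝓖 R W) (ha : 0 ≤ a) (hb : b ≤ R)
    (hI : HasItoIntegral P 𝓖 W a b f I) (hJ : HasItoIntegral P 𝓖 W a b g J) :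
    ∫ ω, I ω * J ω ∂P = ∫ p, f p.1 p.2 * g p.1 p.2 ∂((volume.restrict (Icc a b)).prod P) := by
  obtain ⟨hf, hI2, H, h1, h2⟩ := hI
  obtain ⟨hg, hJ2, K, k1, k2⟩ := hJ
  have t1 := tendsto_integral_mul_of_eLpNorm hI2 hJ2 (fun n => (H n).memLp_integral hW ha hb)
    (fun n => (K n).memLp_integral hW ha hb) h2 k2
  have t2 := tendsto_integral_mul_of_eLpNorm (f := fun p : ℝ × Ω => f p.1 p.2)
    (g := fun p : ℝ × Ω => g p.1 p.2) (F := fun n p => (H n).val p.1 p.2)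
    (G := fun n p => (K n).val p.1 p.2)
    hf hg (fun n => (H n).memLp_val) (fun n => (K n).memLp_val) h1 k1
  exact tendsto_nhds_unique
    (t1.congr fun n => SimpleAdapted.integral_integral_mul hW ha hb (H n) (K n)) t2

/-- The Itô isometry for a linear combination of integrals. -/
theorem HasItoIntegral.eLpNorm_sub_sum (hW : IsBrownianRelTo P 𝓖 R W) (ha : 0 ≤ a) (hb : b ≤ R)
    (hI : HasItoIntegral P 𝓖 W a b f I) {ι : Type*} {S : Finset ι} (c : ι → ℝ)
    {F : ι → ℝ → Ω → ℝ} {K : ι → Ω → ℝ} (hK : ∀ j ∈ S, HasItoIntegral P 𝓖 W a b (F j) (K j)) :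
    eLpNorm (fun ω => I ω - ∑ j ∈ S, c j * K j ω) 2 P =
      eLpNorm (fun p : ℝ × Ω => f p.1 p.2 - ∑ j ∈ S, c j * F j p.1 p.2) 2
        ((volume.restrict (Icc a b)).prod P) := by
  set μ := (volume.restrict (Icc a b)).prod P
  have hf : MemLp (fun p : ℝ × Ω => f p.1 p.2) 2 μ := hI.1
  have hF : ∀ j ∈ S, MemLp (fun p : ℝ × Ω => F j p.1 p.2) 2 μ := fun j hj => (hK j hj).1
  have hI2 : MemLp I 2 P := hI.2.1
  have hK2 : ∀ j ∈ S, MemLp (K j) 2 P := fun j hj => (hK j hj).2.1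
  have hl := memLp_sub_sum (a := c) hI2 hK2
  have hr := memLp_sub_sum (a := c) (F := fun j p => F j p.1 p.2) hf hF
  rw [hl.eLpNorm_eq_sqrt_integral, hr.eLpNorm_eq_sqrt_integral,
    integral_mul_sub_sum hI2 hl hK2, integral_mul_sub_sum (F := fun j p => F j p.1 p.2) hf hr hF]
  simp_rw [fun ω (x : ℝ) => mul_comm (I ω - ∑ j ∈ S, c j * K j ω) x,
    fun (p : ℝ × Ω) (x : ℝ) => mul_comm (f p.1 p.2 - ∑ j ∈ S, c j * F j p.1 p.2) x]
  rw [integral_mul_sub_sum hI2 hI2 hK2,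
    integral_mul_sub_sum (F := fun j p => F j p.1 p.2) hf hf hF]
  congr 3
  · rw [hI.integral_mul hW ha hb hI]
    congr 1
    exact Finset.sum_congr rfl fun j hj => by rw [hI.integral_mul hW ha hb (hK j hj)]
  · refine Finset.sum_congr rfl fun j hj => ?_
    rw [integral_mul_sub_sum hI2 (hK2 j hj) hK2,
      integral_mul_sub_sum (F := fun j p => F j p.1 p.2) hf (hF j hj) hF,
      (hK j hj).integral_mul hW ha hb hI]
    congr 2
    exact Finset.sum_congr rfl fun k hk => by rw [(hK j hj).integral_mul hW ha hb (hK k hk)]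

theorem HasItoIntegral.eLpNorm_sub (hW : IsBrownianRelTo P 𝓖 R W) (ha : 0 ≤ a) (hb : b ≤ R)
    (hI : HasItoIntegral P 𝓖 W a b f I) (hJ : HasItoIntegral P 𝓖 W a b g J) :
    eLpNorm (fun ω => I ω - J ω) 2 P = eLpNorm (fun p : ℝ × Ω => f p.1 p.2 - g p.1 p.2) 2
        ((volume.restrict (Icc a b)).prod P) := by
  simpa using hI.eLpNorm_sub_sum hW ha hb (S := Finset.univ) (fun _ : Unit => (1 : ℝ))
    (F := fun _ => g) (K := fun _ => J) (fun _ _ => hJ)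

theorem HasItoIntegral.ae_eq (hW : IsBrownianRelTo P 𝓖 R W) (ha : 0 ≤ a) (hb : b ≤ R)
    (hI : HasItoIntegral P 𝓖 W a b f I) (hJ : HasItoIntegral P 𝓖 W a b f J) : I =ᵐ[P] J := by
  have h := hI.eLpNorm_sub hW ha hb hJ
  simp only [sub_self, eLpNorm_zero'] at h
  replace h := (eLpNorm_eq_zero_iff (hI.2.1.sub hJ.2.1).aestronglyMeasurable two_ne_zero).1 h
  filter_upwards [h] with ω hω
  exact sub_eq_zero.1 hω

/-- By the isometry, integrals of simple processes converge as soon as the processes do. -/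
theorem exists_hasItoIntegral_of_tendsto (hW : IsBrownianRelTo P 𝓖 R W) (ha : 0 ≤ a) (hb : b ≤ R)
    (hf : MemLp (Function.uncurry f) 2 ((volume.restrict (Icc a b)).prod P))
    {H : ℕ → SimpleAdapted P 𝓖 a b}
    (h : Tendsto (fun n => eLpNorm (fun p : ℝ × Ω => f p.1 p.2 - (H n).val p.1 p.2) 2
      ((volume.restrict (Icc a b)).prod P)) atTop (𝓝 0)) :
    ∃ I, MemLp I 2 P ∧
      Tendsto (fun n => eLpNorm (fun ω => I ω - (H n).integral W ω) 2 P) atTop (𝓝 0) := by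
  have hc := (tendsto_toLp_of_eLpNorm (f := fun p : ℝ × Ω => f p.1 p.2)
    (F := fun n p => (H n).val p.1 p.2) hf (fun n => (H n).memLp_val) h).cauchySeq
  have hm := fun n => (H n).memLp_integral hW ha hb
  have hc' : CauchySeq fun n => (hm n).toLp ((H n).integral W) := by
    rw [cauchySeq_iff_tendsto_dist_atTop_0] at hc ⊢
    refine hc.congr fun n => ?_
    rw [dist_edist, dist_edist, Lp.edist_toLp_toLp, Lp.edist_toLp_toLp]
    congr 1
    exact (((H n.1).hasItoIntegral hW ha hb).eLpNorm_sub hW ha hb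
      ((H n.2).hasItoIntegral hW ha hb)).symm
  obtain ⟨I, hI⟩ := cauchySeq_tendsto_of_complete hc'
  refine ⟨I, Lp.memLp I, ?_⟩
  rw [← Lp.toLp_coeFn I (Lp.memLp I), Lp.tendsto_Lp_iff_tendsto_eLpNorm''] at hI
  refine hI.congr fun n => ?_
  rw [eLpNorm_sub_comm]
  rfl

/-- A square integrable process that is approximated in mean square by simple processes is
Itô integrable. -/
theorem exists_hasItoIntegral_of_approx (hW : IsBrownianRelTo P 𝓖 R W) (ha : 0 ≤ a) (hb : b ≤ R)
    (hf : MemLp (Function.uncurry f) 2 ((volume.restrict (Icc a b)).prod P))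
    (h : ∀ ε : ENNReal, ε ≠ 0 → ∃ H : SimpleAdapted P 𝓖 a b,
      eLpNorm (fun p : ℝ × Ω => f p.1 p.2 - H.val p.1 p.2) 2
        ((volume.restrict (Icc a b)).prod P) ≤ ε) :
    ∃ I, HasItoIntegral P 𝓖 W a b f I := by
  choose H hH using fun n : ℕ => h ((n : ENNReal)⁻¹) (by simp)
  have ht : Tendsto (fun n => eLpNorm (fun p : ℝ × Ω => f p.1 p.2 - (H n).val p.1 p.2) 2
      ((volume.restrict (Icc a b)).prod P)) atTop (𝓝 0) :=
    tendsto_of_tendsto_of_tendsto_of_le_of_le tendsto_const_nhds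
      ENNReal.tendsto_inv_nat_nhds_zero (fun _ => zero_le) hH
  obtain ⟨I, hI, hI'⟩ := exists_hasItoIntegral_of_tendsto hW ha hb hf ht
  exact ⟨I, hf, hI, H, ht, hI'⟩

theorem HasItoIntegral.aestronglyMeasurable_of_le (hW : IsBrownianRelTo P 𝓖 R W) (ha : 0 ≤ a)
    (hb : b ≤ R) {m : MeasurableSpace Ω} (hm : m ≤ mΩ) (hle : ∀ s, 𝓖 s ≤ m)
    (hI : HasItoIntegral P 𝓖 W a b f I) : AEStronglyMeasurable[m] I P := by
  obtain ⟨-, hI2, H, -, h2⟩ := hI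
  have ht := tendsto_toLp_of_eLpNorm hI2 (fun n => (H n).memLp_integral hW ha hb) h2
  have hmem := (isClosed_aestronglyMeasurable (F := ℝ) (p := 2) (μ := P) hm).mem_of_tendsto ht
    (Eventually.of_forall fun n => ?_)
  · exact AEStronglyMeasurable.congr hmem hI2.coeFn_toLp
  · have hmeas : Measurable[m] ((H n).integral W) := by
      refine Finset.measurable_fun_sum _ fun k _ => ?_
      have hW' : ∀ k, Measurable[m] (W ((H n).time k)) := fun k =>
        (hW.adapted _ ⟨ha.trans ((H n).mem k).1, ((H n).mem k).2.trans hb⟩).mono (hle _) le_rfl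
      exact (((H n).meas k).mono (hle _) le_rfl).mul ((hW' (k + 1)).sub (hW' k))
    exact AEStronglyMeasurable.congr hmeas.stronglyMeasurable.aestronglyMeasurable
      (MemLp.coeFn_toLp _).symm

end ItoIntegral

/-! ### Integration of mean-square continuous processes -/

section LeftStep

variable {Ω : Type*} {mΩ : MeasurableSpace Ω} {P : Measure Ω}
  {𝓕 𝓖 : Filtration ℝ mΩ} {R : ℝ} {W : ℝ → Ω → ℝ} {a b : ℝ} {f g : ℝ → Ω → ℝ}

/-- The simple process that freezes `f` at the left end points of the grid of mesh `1 / (N + 1)`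
started at `a`, the last cell being cut off at `b`. -/
noncomputable def leftStep (hab : a ≤ b) (hmeas : ∀ s ∈ Icc a b, Measurable[𝓖 s] (f s))
    (hL2 : ∀ s ∈ Icc a b, MemLp (f s) 2 P) (N : ℕ) : SimpleAdapted P 𝓖 a b where
  n := ⌈(b - a) * (N + 1)⌉₊
  time k := min (a + k / (N + 1)) b
  coef k := f (min (a + k / (N + 1)) b)
  mono k l hkl := by
    have : (k : ℝ) ≤ l := by exact_mod_cast hkl
    dsimp only
    gcongr
  mem k := ⟨le_min (by have : (0 : ℝ) ≤ k / (N + 1) := by positivity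
                       linarith) hab, min_le_right _ _⟩
  meas k := hmeas _ ⟨le_min (by have : (0 : ℝ) ≤ k / (N + 1) := by positivity
                                linarith) hab, min_le_right _ _⟩
  memLp k := hL2 _ ⟨le_min (by have : (0 : ℝ) ≤ k / (N + 1) := by positivity
                               linarith) hab, min_le_right _ _⟩

theorem exists_leftStep_val_eq (hab : a ≤ b) (hmeas : ∀ s ∈ Icc a b, Measurable[𝓖 s] (f s))
    (hL2 : ∀ s ∈ Icc a b, MemLp (f s) 2 P) (N : ℕ) {s : ℝ} (hs : s ∈ Ioc a b) :
    ∃ r ∈ Icc a b, |s - r| ≤ 1 / (N + 1) ∧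
      ∀ ω, (leftStep hab hmeas hL2 N).val s ω = f r ω := by
  have hN : (0 : ℝ) < N + 1 := by positivity
  set x : ℝ := (s - a) * (N + 1) with hx
  have hx0 : 0 < x := mul_pos (sub_pos.2 hs.1) hN
  -- the cell containing `s`
  obtain ⟨k, hk⟩ : ∃ k, ⌈x⌉₊ = k + 1 := Nat.exists_eq_succ_of_ne_zero (Nat.ceil_pos.2 hx0).ne'
  have hkx : (k : ℝ) < x := Nat.lt_ceil.1 (by omega)
  have hxk : x ≤ k + 1 := by exact_mod_cast hk ▸ Nat.le_ceil x
  set H := leftStep hab hmeas hL2 N with hH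
  have hsx : s = a + x / (N + 1) := by rw [hx]; field_simp; ring
  have hlt : a + k / (N + 1) < s := by rw [hsx]; gcongr
  have htk : H.time k = a + k / (N + 1) := min_eq_left (hlt.le.trans hs.2)
  have hle : s ≤ H.time (k + 1) := by
    refine le_min ?_ hs.2
    rw [hsx]
    push_cast
    gcongr
  have hkn : k ∈ Finset.range H.n := by
    rw [Finset.mem_range]
    have : ⌈x⌉₊ ≤ H.n := Nat.ceil_le_ceil (by rw [hx]; gcongr; exact hs.2)
    omega
  refine ⟨H.time k, H.mem k, ?_, fun ω => ?_⟩
  · rw [abs_of_nonneg (by linarith), htk, hsx]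
    have : x / (N + 1) ≤ (k + 1) / (N + 1) := by gcongr
    rw [add_div] at this
    linarith
  · rw [SimpleAdapted.val, Finset.sum_eq_single_of_mem k hkn]
    · exact indicator_of_mem (show s ∈ Ioc _ _ from ⟨htk ▸ hlt, hle⟩) _
    · intro j _ hjk
      refine indicator_of_notMem (fun hj => ?_) _
      rcases lt_or_gt_of_ne hjk with h | h
      · have := H.mono (show j + 1 ≤ k from h)
        linarith [hj.2, htk]
      · have := H.mono (show k + 1 ≤ j from h)
        linarith [hj.1]

/-- `f` is adapted, square integrable, jointly measurable, and uniformly continuous on `[a, b]` as a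
map into `L²(P)`. -/
structure IsMeanSquareRegular (P : Measure Ω) (𝓖 : Filtration ℝ mΩ) (a b : ℝ) (f : ℝ → Ω → ℝ) :
    Prop where
  meas : ∀ s ∈ Icc a b, Measurable[𝓖 s] (f s)
  memLp : ∀ s ∈ Icc a b, MemLp (f s) 2 P
  aestronglyMeasurable :
    AEStronglyMeasurable (Function.uncurry f) ((volume.restrict (Icc a b)).prod P)
  uniformContinuous : ∀ ε > 0, ∃ δ > 0, ∀ s ∈ Icc a b, ∀ r ∈ Icc a b, |s - r| ≤ δ →
    eLpNorm (fun ω => f s ω - f r ω) 2 P ≤ ENNReal.ofReal ε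

theorem eLpNorm_fun_comp_fst [IsProbabilityMeasure P] {α : Type*} {m : MeasurableSpace α}
    {μ : Measure α} [SFinite μ] {h : α → ℝ} (hh : AEStronglyMeasurable h μ) :
    eLpNorm (fun p : α × Ω => h p.1) 2 (μ.prod P) = eLpNorm h 2 μ :=
  eLpNorm_comp_measurePreserving hh measurePreserving_fst

theorem eLpNorm_two_sq_eq_lintegral {α : Type*} {m : MeasurableSpace α} (μ : Measure α)
    (h : α → ℝ) : eLpNorm h 2 μ ^ 2 = ∫⁻ x, ‖h x‖ₑ ^ 2 ∂μ := by
  have := eLpNorm_nnreal_pow_eq_lintegral (f := h) (μ := μ) (p := 2) two_ne_zero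
  simpa using this

theorem aemeasurable_eLpNorm_prod_sq {α : Type*} {m : MeasurableSpace α} {μ : Measure α}
    [SFinite μ] [SFinite P] {G : α → Ω → ℝ}
    (hG : AEStronglyMeasurable (fun p : α × Ω => G p.1 p.2) (μ.prod P)) :
    AEMeasurable (fun s => eLpNorm (G s) 2 P ^ 2) μ := by
  simp_rw [eLpNorm_two_sq_eq_lintegral]
  exact (hG.enorm.pow_const 2).lintegral_prod_right'

theorem eLpNorm_prod_sq {α : Type*} {m : MeasurableSpace α} {μ : Measure α} [SFinite μ]
    [SFinite P] {G : α → Ω → ℝ}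
    (hG : AEStronglyMeasurable (fun p : α × Ω => G p.1 p.2) (μ.prod P)) :
    eLpNorm (fun p : α × Ω => G p.1 p.2) 2 (μ.prod P) ^ 2 = ∫⁻ s, eLpNorm (G s) 2 P ^ 2 ∂μ := by
  simp_rw [eLpNorm_two_sq_eq_lintegral]
  exact lintegral_prod _ (hG.enorm.pow_const 2)

namespace IsMeanSquareRegular

theorem mul_const [IsFiniteMeasure P] {ψ : ℝ → ℝ} (hψ : ContinuousOn ψ (Icc a b)) {Z : Ω → ℝ}
    (hZ : Measurable[𝓖 a] Z) (hZ2 : MemLp Z 2 P) :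
    IsMeanSquareRegular P 𝓖 a b (fun s ω => ψ s * Z ω) where
  meas s hs := measurable_const.mul (hZ.mono (𝓖.mono hs.1) le_rfl)
  memLp s _ := hZ2.const_mul (ψ s)
  aestronglyMeasurable :=
    (hψ.aestronglyMeasurable measurableSet_Icc).comp_fst.mul hZ2.aestronglyMeasurable.comp_snd
  uniformContinuous ε hε := by
    have huc := isCompact_Icc.uniformContinuousOn_of_continuous hψ
    set C := (eLpNorm Z 2 P).toReal with hC
    have hC0 : 0 ≤ C := ENNReal.toReal_nonneg
    obtain ⟨δ, hδ, h⟩ := Metric.uniformContinuousOn_iff.1 huc (ε / (C + 1)) (by positivity)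
    refine ⟨δ / 2, by positivity, fun s hs r hr hsr => ?_⟩
    have hd : |ψ s - ψ r| ≤ ε / (C + 1) :=
      (h s hs r hr (by rw [Real.dist_eq]; linarith)).le
    have he : (fun ω => ψ s * Z ω - ψ r * Z ω) = (ψ s - ψ r) • Z := by
      ext ω; simp [sub_mul]
    rw [he, eLpNorm_const_smul, ← ENNReal.ofReal_toReal hZ2.eLpNorm_ne_top, ← hC,
      Real.enorm_eq_ofReal_abs, ← ENNReal.ofReal_mul (abs_nonneg _)]
    refine ENNReal.ofReal_le_ofReal ?_
    calc |ψ s - ψ r| * C ≤ ε / (C + 1) * (C + 1) := by gcongr; linarith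
      _ = ε := by field_simp

theorem add (hf : IsMeanSquareRegular P 𝓖 a b f) (hg : IsMeanSquareRegular P 𝓖 a b g) :
    IsMeanSquareRegular P 𝓖 a b (fun s ω => f s ω + g s ω) where
  meas s hs := (hf.meas s hs).add (hg.meas s hs)
  memLp s hs := (hf.memLp s hs).add (hg.memLp s hs)
  aestronglyMeasurable := hf.aestronglyMeasurable.add hg.aestronglyMeasurable
  uniformContinuous ε hε := by
    obtain ⟨δ₁, hδ₁, h₁⟩ := hf.uniformContinuous (ε / 2) (by positivity)
    obtain ⟨δ₂, hδ₂, h₂⟩ := hg.uniformContinuous (ε / 2) (by positivity)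
    refine ⟨min δ₁ δ₂, lt_min hδ₁ hδ₂, fun s hs r hr hsr => ?_⟩
    have he : (fun ω => f s ω + g s ω - (f r ω + g r ω)) =
        (fun ω => f s ω - f r ω) + (fun ω => g s ω - g r ω) := by
      ext ω; simp only [Pi.add_apply]; ring
    rw [he, ← add_halves ε, ENNReal.ofReal_add (by positivity) (by positivity)]
    exact (eLpNorm_add_le ((hf.memLp s hs).sub (hf.memLp r hr)).aestronglyMeasurable
      ((hg.memLp s hs).sub (hg.memLp r hr)).aestronglyMeasurable one_le_two).trans
      (add_le_add (h₁ s hs r hr (hsr.trans (min_le_left _ _)))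
        (h₂ s hs r hr (hsr.trans (min_le_right _ _))))

theorem sum [IsFiniteMeasure P] {ι : Type*} (S : Finset ι) {F : ι → ℝ → Ω → ℝ}
    (hF : ∀ j ∈ S, IsMeanSquareRegular P 𝓖 a b (F j)) :
    IsMeanSquareRegular P 𝓖 a b (fun s ω => ∑ j ∈ S, F j s ω) := by
  classical
  induction S using Finset.induction_on with
  | empty =>
    simpa using mul_const (P := P) (𝓖 := 𝓖) (a := a) (b := b) (ψ := fun _ => 0) (Z := fun _ => 0)
      continuousOn_const measurable_const (memLp_const 0)
  | insert j S hj ih =>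
    simp_rw [Finset.sum_insert hj]
    exact (hF j (Finset.mem_insert_self j S)).add
      (ih fun k hk => hF k (Finset.mem_insert_of_mem hk))

variable [IsProbabilityMeasure P]

theorem tendsto_leftStep (hf : IsMeanSquareRegular P 𝓖 a b f) (hab : a ≤ b) :
    Tendsto (fun N => eLpNorm
      (fun p : ℝ × Ω => f p.1 p.2 - (leftStep hab hf.meas hf.memLp N).val p.1 p.2) 2
      ((volume.restrict (Icc a b)).prod P)) atTop (𝓝 0) := by
  rw [ENNReal.tendsto_atTop_zero]
  intro ε hε
  set e : ℝ := (min ε 1).toReal with he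
  have hne : min ε 1 ≠ ⊤ := ne_top_of_le_ne_top ENNReal.one_ne_top (min_le_right _ _)
  have he0 : 0 < e := ENNReal.toReal_pos (lt_min hε one_pos).ne' hne
  have hba : 0 ≤ b - a := sub_nonneg.2 hab
  -- a pointwise error `η` contributes `η² (b - a)` to the squared norm, and this `η` makes that
  -- at most `e²`
  obtain ⟨δ, hδ, h⟩ := hf.uniformContinuous (e / (b - a + 1)) (by positivity)
  obtain ⟨N₀, hN₀⟩ := exists_nat_one_div_lt hδ
  refine ⟨N₀, fun N hN => ?_⟩
  have hNδ : 1 / ((N : ℝ) + 1) ≤ δ := by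
    refine le_trans ?_ hN₀.le
    have : (N₀ : ℝ) ≤ N := by exact_mod_cast hN
    gcongr
  refine le_trans ?_ (min_le_left ε 1)
  rw [← ENNReal.ofReal_toReal hne, ← he, ← ENNReal.pow_le_pow_left_iff two_ne_zero,
    eLpNorm_prod_sq (G := fun s ω => f s ω - (leftStep hab hf.meas hf.memLp N).val s ω)
      (hf.aestronglyMeasurable.sub
      (leftStep hab hf.meas hf.memLp N).memLp_val.aestronglyMeasurable)]
  calc ∫⁻ s in Icc a b, eLpNorm (fun ω => f s ω -
        (leftStep hab hf.meas hf.memLp N).val s ω) 2 P ^ 2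
      ≤ ∫⁻ _ in Icc a b, ENNReal.ofReal (e / (b - a + 1)) ^ 2 := by
        refine lintegral_mono_ae ?_
        rw [← Measure.restrict_congr_set (Ioc_ae_eq_Icc (μ := volume) (a := a) (b := b))]
        filter_upwards [ae_restrict_mem measurableSet_Ioc] with s hs
        obtain ⟨r, hr, hsr, hval⟩ := exists_leftStep_val_eq hab hf.meas hf.memLp N hs
        simp_rw [hval]
        gcongr
        exact h s ⟨hs.1.le, hs.2⟩ r hr (hsr.trans hNδ)
    _ = ENNReal.ofReal ((e / (b - a + 1)) ^ 2 * (b - a)) := by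
        rw [lintegral_const, Measure.restrict_apply_univ, Real.volume_Icc,
          ← ENNReal.ofReal_pow (by positivity), ← ENNReal.ofReal_mul (by positivity)]
    _ ≤ ENNReal.ofReal e ^ 2 := by
        rw [← ENNReal.ofReal_pow he0.le]
        refine ENNReal.ofReal_le_ofReal ?_
        rw [div_pow, div_mul_eq_mul_div, div_le_iff₀ (by positivity)]
        gcongr
        nlinarith

theorem memLp_uncurry (hf : IsMeanSquareRegular P 𝓖 a b f) (hab : a ≤ b) :
    MemLp (Function.uncurry f) 2 ((volume.restrict (Icc a b)).prod P) := by
  obtain ⟨N, hN⟩ := (((hf.tendsto_leftStep hab).eventually (gt_mem_nhds zero_lt_one))).exists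
  set H := leftStep hab hf.meas hf.memLp N
  have h : MemLp (fun p : ℝ × Ω => f p.1 p.2 - H.val p.1 p.2) 2
      ((volume.restrict (Icc a b)).prod P) :=
    ⟨hf.aestronglyMeasurable.sub H.memLp_val.aestronglyMeasurable, hN.trans ENNReal.one_lt_top⟩
  convert! h.add H.memLp_val using 1
  ext p
  simp [Function.uncurry]

theorem exists_hasItoIntegral (hf : IsMeanSquareRegular P 𝓖 a b f) (hW : IsBrownianRelTo P 𝓖 R W)
    (ha : 0 ≤ a) (hab : a ≤ b) (hb : b ≤ R) : ∃ I, HasItoIntegral P 𝓖 W a b f I := by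
  obtain ⟨I, hI, hI'⟩ := exists_hasItoIntegral_of_tendsto hW ha hb (hf.memLp_uncurry hab)
    (hf.tendsto_leftStep hab)
  exact ⟨I, hf.memLp_uncurry hab, hI, _, hf.tendsto_leftStep hab, hI'⟩

theorem tendstoInMeasure_leftStep_integral (hf : IsMeanSquareRegular P 𝓖 a b f)
    (hW : IsBrownianRelTo P 𝓖 R W) (ha : 0 ≤ a) (hab : a ≤ b) (hb : b ≤ R) {I : Ω → ℝ}
    (hI : HasItoIntegral P 𝓖 W a b f I) :
    TendstoInMeasure P (fun N => (leftStep hab hf.meas hf.memLp N).integral W) atTop I := by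
  refine tendstoInMeasure_of_tendsto_eLpNorm two_ne_zero
    (fun N => ((leftStep hab hf.meas hf.memLp N).memLp_integral hW ha hb).aestronglyMeasurable)
    hI.2.1.aestronglyMeasurable ((hf.tendsto_leftStep hab).congr fun N => ?_)
  rw [eLpNorm_sub_comm]
  exact (hI.eLpNorm_sub hW ha hb
    ((leftStep hab hf.meas hf.memLp N).hasItoIntegral hW ha hb)).symm

end IsMeanSquareRegular

variable [IsProbabilityMeasure P]

/-- A factor that is known at the initial time can be taken out of the Itô integral of a continuous
deterministic function. -/
theorem HasItoIntegral.mul_const (hW : IsBrownianRelTo P 𝓖 R W) (ha : 0 ≤ a) (hab : a ≤ b)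
    (hb : b ≤ R) {ψ : ℝ → ℝ} (hψ : ContinuousOn ψ (Icc a b)) {Z : Ω → ℝ}
    (hZ : Measurable[𝓖 a] Z) (hZ2 : MemLp Z 2 P) {η : Ω → ℝ}
    (hη : HasItoIntegral P 𝓖 W a b (fun s _ => ψ s) η) :
    HasItoIntegral P 𝓖 W a b (fun s ω => ψ s * Z ω) (fun ω => Z ω * η ω) := by
  have hreg := IsMeanSquareRegular.mul_const (P := P) (𝓖 := 𝓖) hψ hZ hZ2
  have hreg1 : IsMeanSquareRegular P 𝓖 a b (fun s _ => ψ s) := by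
    simpa using IsMeanSquareRegular.mul_const (P := P) (𝓖 := 𝓖) hψ (Z := fun _ => 1)
      measurable_const (memLp_const 1)
  obtain ⟨B, hB⟩ := hreg.exists_hasItoIntegral hW ha hab hb
  refine hB.congr (ae_eq_refl _) ?_
  -- both sides are limits, along a common subsequence, of the integrals of the step processes
  obtain ⟨n₁, hn₁, h₁⟩ :=
    (hreg.tendstoInMeasure_leftStep_integral hW ha hab hb hB).exists_seq_tendsto_ae
  obtain ⟨n₂, hn₂, h₂⟩ := TendstoInMeasure.exists_seq_tendsto_ae
    (fun ε hε => (hreg1.tendstoInMeasure_leftStep_integral hW ha hab hb hη ε hε).comp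
      hn₁.tendsto_atTop)
  filter_upwards [h₁, h₂] with ω hω₁ hω₂
  refine tendsto_nhds_unique (hω₁.comp hn₂.tendsto_atTop) ?_
  refine (hω₂.const_mul (Z ω)).congr fun k => ?_
  simp only [Function.comp, SimpleAdapted.integral, leftStep, Finset.mul_sum]
  exact Finset.sum_congr rfl fun j _ => by ring

/-- Deterministic square integrable functions are Itô integrable. -/
theorem exists_hasItoIntegral_deterministic (hW : IsBrownianRelTo P 𝓖 R W) (ha : 0 ≤ a)
    (hab : a ≤ b) (hb : b ≤ R) {φ : ℝ → ℝ} (hφ : MemLp φ 2 (volume.restrict (Icc a b))) :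
    ∃ I, HasItoIntegral P 𝓖 W a b (fun s _ => φ s) I := by
  refine exists_hasItoIntegral_of_approx hW ha hb (hφ.comp_fst P) fun ε hε => ?_
  obtain ⟨g, hg, hg2⟩ := hφ.exists_boundedContinuous_eLpNorm_sub_le (by simp)
    (ENNReal.half_pos hε).ne'
  have hreg : IsMeanSquareRegular P 𝓖 a b (fun s _ => g s) := by
    simpa using IsMeanSquareRegular.mul_const (P := P) (𝓖 := 𝓖) (a := a) (b := b)
      (ψ := g) g.continuous.continuousOn (Z := fun _ => 1) measurable_const (memLp_const 1)
  obtain ⟨N, hN⟩ := ((hreg.tendsto_leftStep hab).eventually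
    (gt_mem_nhds (ENNReal.half_pos hε))).exists
  set H := leftStep hab hreg.meas hreg.memLp N
  refine ⟨H, ?_⟩
  have he : (fun p : ℝ × Ω => φ p.1 - H.val p.1 p.2) =
      (fun p => (φ - g) p.1) + fun p => g p.1 - H.val p.1 p.2 := by
    ext p; simp
  rw [he, ← ENNReal.add_halves ε]
  refine (eLpNorm_add_le ((hφ.sub hg2).comp_fst P).aestronglyMeasurable
    ((hg2.comp_fst P).sub H.memLp_val).aestronglyMeasurable one_le_two).trans
    (add_le_add ?_ hN.le)
  rw [eLpNorm_fun_comp_fst (hφ.sub hg2).aestronglyMeasurable]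
  exact hg

end LeftStep

/-! ### Wiener increments as integrands and as integrals -/

section Increments

variable {Ω : Type*} {mΩ : MeasurableSpace Ω} {P : Measure Ω} [IsProbabilityMeasure P]
  {𝓕 𝓖 : Filtration ℝ mΩ} {R : ℝ}

theorem IsBrownianRelTo.hasItoIntegral_indicator {W : ℝ → Ω → ℝ} (hW : IsBrownianRelTo P 𝓖 R W)
    {a b s : ℝ} (ha : 0 ≤ a) (hb : b ≤ R) (hs : s ∈ Icc a b) :
    HasItoIntegral P 𝓖 W a b (fun r _ => (Ioc a s).indicator (fun _ => 1) r)
      (fun ω => W s ω - W a ω) := by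
  let H : SimpleAdapted P 𝓖 a b :=
    { n := 1
      time := fun k => if k = 0 then a else s
      coef := fun _ _ => 1
      mono := monotone_nat_of_le_succ fun k => by
        by_cases hk : k = 0 <;> simp [hk, hs.1]
      mem := fun k => by
        by_cases hk : k = 0
        · simpa [hk] using hs.1.trans hs.2
        · simpa [hk] using hs
      meas := fun _ => measurable_const
      memLp := fun _ => memLp_const 1 }
  convert! H.hasItoIntegral hW ha hb using 1
  · ext r ω
    simp [SimpleAdapted.val, H]
  · ext ω
    simp [SimpleAdapted.integral, H]

theorem IsBrownianRelTo.hasItoIntegral_one {W : ℝ → Ω → ℝ} (hW : IsBrownianRelTo P 𝓖 R W)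
    {a b : ℝ} (ha : 0 ≤ a) (hab : a ≤ b) (hb : b ≤ R) :
    HasItoIntegral P 𝓖 W a b (fun _ _ => 1) (fun ω => W b ω - W a ω) := by
  refine (hW.hasItoIntegral_indicator ha hb (right_mem_Icc.2 hab)).congr ?_ (ae_eq_refl _)
  rw [← Measure.restrict_congr_set (Ioc_ae_eq_Icc (μ := volume) (a := a) (b := b))]
  filter_upwards [Measure.quasiMeasurePreserving_fst.ae (ae_restrict_mem measurableSet_Ioc)]
    with p hp
  change (Ioc a b).indicator (fun _ => (1 : ℝ)) p.1 = 1
  exact indicator_of_mem hp _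

variable {d : ℕ} {w : Fin d → ℝ → Ω → ℝ}

/-- The increments of a Wiener process from a fixed time on.  Joint measurability comes from the
left step approximations, which converge along every continuous path. -/
theorem IsWienerProcess.isMeanSquareRegular_increment (hw : IsWienerProcess P 𝓕 R w) (i : Fin d)
    {a b : ℝ} (ha : 0 ≤ a) (hab : a ≤ b) (hb : b ≤ R) :
    IsMeanSquareRegular P 𝓕 a b (fun s ω => w i s ω - w i a ω) := by
  have hW := hw.isBrownianRelTo i
  have hsub : Icc a b ⊆ Icc 0 R := Icc_subset_Icc ha hb
  have hmeas : ∀ s ∈ Icc a b, Measurable[𝓕 s] (fun ω => w i s ω - w i a ω) := fun s hs =>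
    (hw.adapted i s (hsub hs)).sub
      ((hw.adapted i a (hsub (left_mem_Icc.2 hab))).mono (𝓕.mono hs.1) le_rfl)
  have hL2 : ∀ s ∈ Icc a b, MemLp (fun ω => w i s ω - w i a ω) 2 P := fun s hs =>
    hW.memLp_increment ha hs.1 (hs.2.trans hb)
  refine ⟨hmeas, hL2, ?_, fun ε hε => ⟨ε ^ 2, by positivity, fun s hs r hr hsr => ?_⟩⟩
  · refine aestronglyMeasurable_of_tendsto_ae atTop
      (f := fun N (p : ℝ × Ω) => (leftStep hab hmeas hL2 N).val p.1 p.2)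
      (fun N => (leftStep hab hmeas hL2 N).memLp_val.aestronglyMeasurable) ?_
    rw [← Measure.restrict_congr_set (Ioc_ae_eq_Icc (μ := volume) (a := a) (b := b))]
    filter_upwards [Measure.quasiMeasurePreserving_fst.ae (ae_restrict_mem measurableSet_Ioc),
      Measure.quasiMeasurePreserving_snd.ae (hw.continuous i)] with p hp hc
    choose r hr hpr hval using fun N => exists_leftStep_val_eq hab hmeas hL2 N hp
    simp_rw [hval]
    have hrp : Tendsto r atTop (𝓝 p.1) := by
      rw [tendsto_iff_dist_tendsto_zero]
      refine squeeze_zero (fun _ => dist_nonneg) (fun N => ?_)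
        (tendsto_one_div_add_atTop_nhds_zero_nat (𝕜 := ℝ))
      rw [dist_comm]
      exact hpr N
    have hlim := (hc p.1 (hsub ⟨hp.1.le, hp.2⟩)).tendsto.comp
      (tendsto_nhdsWithin_iff.2 ⟨hrp, Eventually.of_forall fun N => hsub (hr N)⟩)
    exact hlim.sub_const _
  · wlog h : s ≤ r generalizing s r
    · have := this r hr s hs (by rwa [abs_sub_comm]) (le_of_not_ge h)
      exact (eLpNorm_sub_comm (fun ω => w i s ω - w i a ω)
        (fun ω => w i r ω - w i a ω) 2 P).trans_le this
    have he : (fun ω => w i s ω - w i a ω - (w i r ω - w i a ω)) =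
        -(fun ω => w i r ω - w i s ω) := by
      ext ω; simp only [Pi.neg_apply]; ring
    have hs0 := hsub hs
    have hr0 := hsub hr
    rw [he, eLpNorm_neg, (hW.memLp_increment hs0.1 h hr0.2).eLpNorm_eq_sqrt_integral]
    refine ENNReal.ofReal_le_ofReal (Real.sqrt_le_iff.2 ⟨hε.le, ?_⟩)
    simp_rw [← sq]
    rw [hW.integral_increment_sq hs0.1 h hr0.2]
    rw [abs_sub_comm] at hsr
    exact (le_abs_self _).trans hsr

/-- The Wiener integral of a deterministic function is measurable, up to a null set, with respect to
the path of the integrator: it can be computed in the filtration that retains from `𝓕` only the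
events determined by this path. -/
theorem IsWienerProcess.exists_measurable_path_ae_eq (hw : IsWienerProcess P 𝓕 R w) (i : Fin d)
    {a b : ℝ} (ha : 0 ≤ a) (hab : a ≤ b) (hb : b ≤ R) {φ : ℝ → ℝ}
    (hφ : MemLp φ 2 (volume.restrict (Icc a b))) {ζ : Ω → ℝ}
    (hζ : HasItoIntegral P 𝓕 (w i) a b (fun s _ => φ s) ζ) :
    ∃ Z, Measurable[⨆ u ∈ Icc 0 R, MeasurableSpace.comap (w i u) inferInstance] Z ∧
      ζ =ᵐ[P] Z := by
  set m := ⨆ u ∈ Icc 0 R, MeasurableSpace.comap (w i u) inferInstance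
  have hm : m ≤ mΩ := iSup₂_le fun u hu => (hw.measurable i hu).comap_le
  let 𝓗 : Filtration ℝ mΩ := 𝓕 ⊓ Filtration.const ℝ m hm
  have hle : ∀ s, 𝓗 s ≤ 𝓕 s := fun s => inf_le_left
  have hlem : ∀ s, 𝓗 s ≤ m := fun s => inf_le_right
  have hW := hw.isBrownianRelTo i
  have hW' : IsBrownianRelTo P 𝓗 R (w i) := hW.of_le hle fun s hs => by
    refine measurable_iff_comap_le.2 (le_inf (hw.adapted i s hs).comap_le ?_)
    exact le_iSup₂ (f := fun u (_ : u ∈ Icc 0 R) => MeasurableSpace.comap (w i u) inferInstance)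
      s hs
  obtain ⟨ζ', hζ'⟩ := exists_hasItoIntegral_deterministic hW' ha hab hb hφ
  have hmeas := hζ'.aestronglyMeasurable_of_le hW' ha hb hm hlem
  exact ⟨hmeas.mk ζ', hmeas.stronglyMeasurable_mk.measurable,
    (hζ.ae_eq hW ha hb (hζ'.ofLE hle)).trans hmeas.ae_eq_mk⟩

end Increments

/-! ### Expansion of an indicator in a complete orthonormal system -/

section Expansion

theorem Orthonormal.norm_sub_sum_inner_smul_le {E ι : Type*} [NormedAddCommGroup E]
    [InnerProductSpace ℝ E] {e : ι → E} (he : Orthonormal ℝ e) (S : Finset ι) (x : E) :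
    ‖x - ∑ j ∈ S, inner ℝ (e j) x • e j‖ ≤ ‖x‖ := by
  set p := ∑ j ∈ S, inner ℝ (e j) x • e j with hp
  have h0 : inner ℝ (x - p) p = 0 := by
    rw [hp, inner_sum]
    refine Finset.sum_eq_zero fun j hj => ?_
    rw [← hp, inner_smul_right, inner_sub_left, hp, he.inner_left_sum _ hj,
      real_inner_comm (e j) x]
    simp
  have h1 := norm_add_sq_real (x - p) p
  rw [sub_add_cancel, h0] at h1
  refine le_of_sq_le_sq ?_ (norm_nonneg x)
  nlinarith [sq_nonneg ‖p‖]

variable {t T : ℝ} {φ : ℕ → ℝ → ℝ}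

theorem memLp_one_indicator_Ioc (t T s : ℝ) :
    MemLp ((Ioc t s).indicator fun _ => (1 : ℝ)) 2 (volume.restrict (Icc t T)) :=
  (memLp_const 1).indicator measurableSet_Ioc

namespace IsCompleteOrthonormalSystem

theorem intervalIntegrable (hφ : IsCompleteOrthonormalSystem t T φ) (htT : t ≤ T) (j : ℕ) :
    IntervalIntegrable (φ j) volume t T := by
  rw [intervalIntegrable_iff_integrableOn_Icc_of_le htT]
  exact (hφ.1 j).integrable one_le_two

theorem continuousOn_primitive (hφ : IsCompleteOrthonormalSystem t T φ) (htT : t ≤ T) (j : ℕ) :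
    ContinuousOn (fun s => ∫ τ in t..s, φ j τ) (Icc t T) := by
  have h := intervalIntegral.continuousOn_primitive_interval' (hφ.intervalIntegrable htT j)
    left_mem_uIcc
  rwa [uIcc_of_le htT] at h

theorem inner_toLp_indicator (hφ : IsCompleteOrthonormalSystem t T φ) {s : ℝ}
    (hs : s ∈ Icc t T) (j : ℕ) :
    inner ℝ ((hφ.1 j).toLp (φ j)) ((memLp_one_indicator_Ioc t T s).toLp _) =
      ∫ τ in t..s, φ j τ := by
  rw [(hφ.1 j).inner_toLp_eq_integral (memLp_one_indicator_Ioc t T s)]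
  have h : (fun x => φ j x * (Ioc t s).indicator (fun _ => (1 : ℝ)) x) =
      (Ioc t s).indicator (φ j) := by
    ext x
    by_cases hx : x ∈ Ioc t s <;> simp [hx]
  rw [h, integral_indicator measurableSet_Ioc, Measure.restrict_restrict measurableSet_Ioc,
    inter_eq_self_of_subset_left (Ioc_subset_Icc_self.trans (Icc_subset_Icc_right hs.2)),
    intervalIntegral.integral_of_le hs.1]

/-- The `m`-th remainder of the expansion of `1_{(t, s]}`, as an element of `L²([t, T])`. -/
theorem eLpNorm_indicator_sub_sum (hφ : IsCompleteOrthonormalSystem t T φ) {s : ℝ}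
    (hs : s ∈ Icc t T) (S : Finset ℕ) :
    eLpNorm (fun r => (Ioc t s).indicator (fun _ => (1 : ℝ)) r -
      ∑ j ∈ S, (∫ τ in t..s, φ j τ) * φ j r) 2 (volume.restrict (Icc t T)) =
      ‖(memLp_one_indicator_Ioc t T s).toLp _ - ∑ j ∈ S, inner ℝ ((hφ.1 j).toLp (φ j))
        ((memLp_one_indicator_Ioc t T s).toLp _) • (hφ.1 j).toLp (φ j)‖ₑ := by
  rw [Lp.enorm_def]
  refine eLpNorm_congr_ae ?_
  have hsum : ∀ S : Finset ℕ, (∑ j ∈ S, inner ℝ ((hφ.1 j).toLp (φ j))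
        ((memLp_one_indicator_Ioc t T s).toLp _) • (hφ.1 j).toLp (φ j) : Lp ℝ 2 _)
      =ᵐ[volume.restrict (Icc t T)] fun r => ∑ j ∈ S, (∫ τ in t..s, φ j τ) * φ j r := by
    intro S
    induction S using Finset.induction_on with
    | empty =>
      simp only [Finset.sum_empty]
      exact Lp.coeFn_zero ℝ 2 (volume.restrict (Icc t T))
    | insert j S hj ih =>
      simp_rw [Finset.sum_insert hj]
      refine (Lp.coeFn_add _ _).trans ?_
      filter_upwards [ih, Lp.coeFn_smul (inner ℝ ((hφ.1 j).toLp (φ j))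
        ((memLp_one_indicator_Ioc t T s).toLp _)) ((hφ.1 j).toLp (φ j)), (hφ.1 j).coeFn_toLp]
        with r h1 h2 h3
      rw [Pi.add_apply, h1, h2, Pi.smul_apply, h3, hφ.inner_toLp_indicator hs, smul_eq_mul]
  filter_upwards [Lp.coeFn_sub ((memLp_one_indicator_Ioc t T s).toLp _) (∑ j ∈ S,
    inner ℝ ((hφ.1 j).toLp (φ j)) ((memLp_one_indicator_Ioc t T s).toLp _) • (hφ.1 j).toLp (φ j)),
    hsum S, (memLp_one_indicator_Ioc t T s).coeFn_toLp] with r h1 h2 h3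
  rw [h1, Pi.sub_apply, h2, h3]

theorem eLpNorm_indicator_sub_sum_le (hφ : IsCompleteOrthonormalSystem t T φ) {s : ℝ}
    (hs : s ∈ Icc t T) (S : Finset ℕ) :
    eLpNorm (fun r => (Ioc t s).indicator (fun _ => (1 : ℝ)) r -
      ∑ j ∈ S, (∫ τ in t..s, φ j τ) * φ j r) 2 (volume.restrict (Icc t T)) ≤
      eLpNorm (fun _ => (1 : ℝ)) 2 (volume.restrict (Icc t T)) := by
  rw [hφ.eLpNorm_indicator_sub_sum hs]
  refine (enorm_le_iff_norm_le.2 (hφ.2.1.norm_sub_sum_inner_smul_le S _)).trans ?_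
  rw [Lp.enorm_toLp]
  exact eLpNorm_indicator_le _

theorem tendsto_eLpNorm_indicator_sub_sum (hφ : IsCompleteOrthonormalSystem t T φ) {s : ℝ}
    (hs : s ∈ Icc t T) :
    Tendsto (fun m => eLpNorm (fun r => (Ioc t s).indicator (fun _ => (1 : ℝ)) r -
      ∑ j ∈ Finset.range (m + 1), (∫ τ in t..s, φ j τ) * φ j r) 2 (volume.restrict (Icc t T)))
      atTop (𝓝 0) := by
  simp_rw [hφ.eLpNorm_indicator_sub_sum hs]
  have h := ((HilbertBasis.mk hφ.2.1 hφ.2.2.ge).hasSum_repr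
    ((memLp_one_indicator_Ioc t T s).toLp _)).tendsto_sum_nat.comp (tendsto_add_atTop_nat 1)
  simp only [HilbertBasis.repr_apply_apply, HilbertBasis.coe_mk] at h
  have h' := (h.const_sub ((memLp_one_indicator_Ioc t T s).toLp _)).enorm
  simpa using h'

end IsCompleteOrthonormalSystem

end Expansion

/-! ### The approximation of the double integral -/

section Approximation

variable {Ω : Type*} {mΩ : MeasurableSpace Ω} {P : Measure Ω} [IsProbabilityMeasure P]
  {𝓕 : Filtration ℝ mΩ} {R : ℝ} {V : ℝ → Ω → ℝ} {t T : ℝ} {φ : ℕ → ℝ → ℝ}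

/-- The truncated increments converge to the Wiener increments in `L²([t, T] × Ω)`: for fixed `s`
the error is, by the Itô isometry, the remainder of the expansion of `1_{(t, s]}`. -/
theorem tendsto_eLpNorm_sub_truncatedIncrement (hV : IsBrownianRelTo P 𝓕 R V) (ht : 0 ≤ t)
    (hTR : T ≤ R) (hφ : IsCompleteOrthonormalSystem t T φ) {Y : ℝ → Ω → ℝ}
    (hY : ∀ s ∈ Icc t T, HasItoIntegral P 𝓕 V t s (fun _ _ => 1) (Y s)) {ζ : ℕ → Ω → ℝ}
    (hζ : ∀ j, HasItoIntegral P 𝓕 V t T (fun s _ => φ j s) (ζ j))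
    (hmeas : ∀ m, AEStronglyMeasurable
      (fun p : ℝ × Ω => Y p.1 p.2 - truncatedIncrement φ ζ t m p.1 p.2)
      ((volume.restrict (Icc t T)).prod P)) :
    Tendsto (fun m => eLpNorm
      (fun p : ℝ × Ω => Y p.1 p.2 - truncatedIncrement φ ζ t m p.1 p.2) 2
      ((volume.restrict (Icc t T)).prod P)) atTop (𝓝 0) := by
  have hslice : ∀ m, ∀ s ∈ Icc t T,
      eLpNorm (fun ω => Y s ω - truncatedIncrement φ ζ t m s ω) 2 P =
      eLpNorm (fun r => (Ioc t s).indicator (fun _ => (1 : ℝ)) r -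
        ∑ j ∈ Finset.range (m + 1), (∫ τ in t..s, φ j τ) * φ j r) 2
        (volume.restrict (Icc t T)) := by
    intro m s hs
    have hYs := (hY s hs).ae_eq hV ht (hs.2.trans hTR)
      (hV.hasItoIntegral_one ht hs.1 (hs.2.trans hTR))
    have hI := (hV.hasItoIntegral_indicator ht hTR hs).congr (ae_eq_refl _) hYs.symm
    have hrem : MemLp (fun r => (Ioc t s).indicator (fun _ => (1 : ℝ)) r -
        ∑ j ∈ Finset.range (m + 1), (∫ τ in t..s, φ j τ) * φ j r) 2
        (volume.restrict (Icc t T)) :=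
      memLp_sub_sum (memLp_one_indicator_Ioc t T s) fun j _ => hφ.1 j
    rw [← eLpNorm_fun_comp_fst (P := P) hrem.aestronglyMeasurable]
    simp only [truncatedIncrement]
    exact hI.eLpNorm_sub_sum hV ht hTR (S := Finset.range (m + 1))
      (fun j => ∫ τ in t..s, φ j τ) (F := fun j r _ => φ j r) (K := ζ) (fun j _ => hζ j)
  have haem : ∀ m, AEMeasurable
      (fun s => eLpNorm (fun ω => Y s ω - truncatedIncrement φ ζ t m s ω) 2 P ^ 2)
      (volume.restrict (Icc t T)) := fun m => aemeasurable_eLpNorm_prod_sq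
      (G := fun s ω => Y s ω - truncatedIncrement φ ζ t m s ω) (hmeas m)
  have hlim : Tendsto (fun m => ∫⁻ s in Icc t T,
      eLpNorm (fun ω => Y s ω - truncatedIncrement φ ζ t m s ω) 2 P ^ 2) atTop
      (𝓝 (∫⁻ _ in Icc t T, 0)) := by
    refine tendsto_lintegral_of_dominated_convergence'
      (fun _ => eLpNorm (fun _ => (1 : ℝ)) 2 (volume.restrict (Icc t T)) ^ 2)
      haem (fun m => ?_) ?_ ?_
    · filter_upwards [ae_restrict_mem measurableSet_Icc] with s hs
      rw [hslice m s hs]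
      exact pow_le_pow_left₀ zero_le (hφ.eLpNorm_indicator_sub_sum_le hs _) 2
    · rw [lintegral_const]
      exact ENNReal.mul_ne_top (ENNReal.pow_ne_top (memLp_const 1).eLpNorm_ne_top)
        (measure_ne_top _ _)
    · filter_upwards [ae_restrict_mem measurableSet_Icc] with s hs
      simp_rw [fun m => hslice m s hs]
      simpa using ENNReal.Tendsto.pow (n := 2) (hφ.tendsto_eLpNorm_indicator_sub_sum hs)
  have hsq : Tendsto (fun m => eLpNorm
      (fun p : ℝ × Ω => Y p.1 p.2 - truncatedIncrement φ ζ t m p.1 p.2) 2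
      ((volume.restrict (Icc t T)).prod P) ^ 2) atTop (𝓝 0) := by
    rw [lintegral_zero] at hlim
    exact hlim.congr fun m => (eLpNorm_prod_sq
      (G := fun s ω => Y s ω - truncatedIncrement φ ζ t m s ω) (hmeas m)).symm
  have h := (ENNReal.continuous_rpow_const (y := 1 / 2)).tendsto 0 |>.comp hsq
  simp only [Function.comp_def, one_div, ENNReal.zero_rpow_of_pos (show (0 : ℝ) < 2⁻¹ by norm_num)]
    at h
  refine h.congr fun m => ?_
  rw [← ENNReal.rpow_natCast, ← ENNReal.rpow_mul]
  norm_num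

end Approximation

theorem theorem2 {Ω : Type*} {mΩ : MeasurableSpace Ω} (P : Measure Ω) [IsProbabilityMeasure P]
    (𝓕 : Filtration ℝ mΩ) (R : ℝ) {d : ℕ} (w : Fin d → ℝ → Ω → ℝ)
    (hw : IsWienerProcess P 𝓕 R w)
    (t T : ℝ) (ht : 0 ≤ t) (htT : t < T) (hTR : T ≤ R)
    (i₁ i₂ : Fin d) (hi : i₁ ≠ i₂)
    (φ : ℕ → ℝ → ℝ) (hφ : IsCompleteOrthonormalSystem t T φ) :
    -- all the stochastic integrals below exist
    (∃ J, HasDoubleItoIntegral P 𝓕 (w i₁) (w i₂) t T J) ∧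
    (∀ j, ∃ ζ, HasItoIntegral P 𝓕 (w i₁) t T (fun s _ => φ j s) ζ) ∧
    (∀ j, ∃ η, HasItoIntegral P 𝓕 (w i₂) t T (fun s _ => ∫ τ in t..s, φ j τ) η) ∧
    ∀ J, HasDoubleItoIntegral P 𝓕 (w i₁) (w i₂) t T J →
    ∀ ζ : ℕ → Ω → ℝ, (∀ j, HasItoIntegral P 𝓕 (w i₁) t T (fun s _ => φ j s) (ζ j)) →
    ∀ η : ℕ → Ω → ℝ,
      (∀ j, HasItoIntegral P 𝓕 (w i₂) t T (fun s _ => ∫ τ in t..s, φ j τ) (η j)) →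
      (∀ m, ∃ A, HasItoIntegral P (hw.enlarge i₁) (w i₂) t T (truncatedIncrement φ ζ t m) A) ∧
      ∀ A : ℕ → Ω → ℝ,
        (∀ m, HasItoIntegral P (hw.enlarge i₁) (w i₂) t T (truncatedIncrement φ ζ t m) (A m)) →
        -- the approximations are the stated finite sums, and they converge in mean square
        (∀ m, A m =ᵐ[P] fun ω => ∑ j ∈ Finset.range (m + 1), ζ j ω * η j ω) ∧
        Tendsto (fun m => eLpNorm (fun ω => J ω - A m ω) 2 P) atTop (𝓝 0) := by
  have hV := hw.isBrownianRelTo i₁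
  have hW := hw.isBrownianRelTo i₂
  have hG : IsBrownianRelTo P (hw.enlarge i₁) R (w i₂) := hw.isBrownianRelTo_enlarge hi
  have hψ := hφ.continuousOn_primitive htT.le
  refine ⟨?_, fun j => exists_hasItoIntegral_deterministic hV ht htT.le hTR (hφ.1 j),
    fun j => ?_, ?_⟩
  · obtain ⟨J, hJ⟩ := (hw.isMeanSquareRegular_increment i₁ ht htT.le hTR).exists_hasItoIntegral
      hW ht htT.le hTR
    exact ⟨J, _, fun s hs => hV.hasItoIntegral_one ht hs.1 (hs.2.trans hTR), hJ⟩
  · have hreg := IsMeanSquareRegular.mul_const (P := P) (𝓖 := 𝓕) (hψ j) (Z := fun _ => 1)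
      measurable_const (memLp_const 1)
    simp only [mul_one] at hreg
    exact hreg.exists_hasItoIntegral hW ht htT.le hTR
  rintro J ⟨Y, hY, hJ⟩ ζ hζ η hη
  -- versions of the `ζ j` that are known at time `t` in the enlarged filtration
  choose Z hZ hζZ using fun j =>
    hw.exists_measurable_path_ae_eq i₁ ht htT.le hTR (hφ.1 j) (hζ j)
  have hZm : ∀ j, Measurable[hw.enlarge i₁ t] (Z j) := fun j =>
    (hZ j).mono (hw.path_le_enlarge i₁ t) le_rfl
  have hZ2 : ∀ j, MemLp (Z j) 2 P := fun j => (hζ j).2.1.ae_eq (hζZ j)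
  have hZζ : ∀ᵐ p ∂((volume.restrict (Icc t T)).prod P), ∀ j, Z j p.2 = ζ j p.2 :=
    Measure.quasiMeasurePreserving_snd.ae
      (ae_all_iff.2 fun j => (hζZ j).mono fun _ h => h.symm)
  have hterm : ∀ j, HasItoIntegral P (hw.enlarge i₁) (w i₂) t T
      (fun s ω => (∫ τ in t..s, φ j τ) * ζ j ω) (fun ω => ζ j ω * η j ω) := by
    intro j
    refine (((hη j).ofLE (hw.le_enlarge i₁)).mul_const hG ht htT.le hTR (hψ j) (hZm j)
      (hZ2 j)).congr ?_ ?_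
    · filter_upwards [hZζ] with p hp
      simp [Function.uncurry, hp j]
    · filter_upwards [hζZ j] with ω hω
      rw [hω]
  refine ⟨fun m => ?_, fun A hA => ⟨fun m => ?_, ?_⟩⟩
  · obtain ⟨A, hA⟩ := (IsMeanSquareRegular.sum (Finset.range (m + 1)) fun j _ =>
      IsMeanSquareRegular.mul_const (hψ j) (hZm j) (hZ2 j)).exists_hasItoIntegral hG ht htT.le hTR
    refine ⟨A, hA.congr ?_ (ae_eq_refl _)⟩
    filter_upwards [hZζ] with p hp
    simp [Function.uncurry, truncatedIncrement, hp]
  · have h := (hA m).eLpNorm_sub_sum hG ht hTR (S := Finset.range (m + 1)) (fun _ => 1)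
      fun j _ => hterm j
    simp only [truncatedIncrement, one_mul, sub_self, eLpNorm_zero'] at h
    have hmem : MemLp (fun ω => A m ω - ∑ j ∈ Finset.range (m + 1), ζ j ω * η j ω) 2 P :=
      (hA m).2.1.sub (memLp_finsetSum _ fun j _ => (hterm j).2.1)
    filter_upwards [(eLpNorm_eq_zero_iff hmem.aestronglyMeasurable two_ne_zero).1 h] with ω hω
    exact sub_eq_zero.1 hω
  · refine (tendsto_eLpNorm_sub_truncatedIncrement hV ht hTR hφ hY hζ fun m =>
      hJ.1.aestronglyMeasurable.sub (hA m).1.aestronglyMeasurable).congr fun m => ?_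
    exact ((hJ.ofLE (hw.le_enlarge i₁)).eLpNorm_sub hG ht hTR (hA m)).symm
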